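/- Let $n_1,\dots,n_k$ ($k\ge 1$) be non-zero integers such that the 2-bridge link with Conway diagram $K=C[n_1,\dots,n_k]$ is a knot, and fix an orientation of $K$. Here $C[n_1,\dots,n_k]$ is the four-strand diagram with two caps at the top (joining strands 1,2 and 3,4), followed by blocks of $|n_1|,\dots,|n_k|$ crossings, alternately between strands 2,3 (first block) and strands 1,2, right-handed if $(-1)^{i+1}n_i>0$ and left-handed otherwise, and closed at the bottom by joining strands 1,2 and 3,4 if $k$ is odd, and strands 2,3 and 1,4 if $k$ is even. Write $\langle x,y\rangle=\det(x,y)$ and $x\rhd^{\pm1}y=x\pm\langle x,y\rangle y$. Give the two arcs at the top caps the vectors $a=(1,0)^T$ and $b=(0,u)^T$, so that $\langle a,b\rangle=u$, and determine vectors with entries in $\mathbb Z[u]$ for the other arcs by descending through the diagram: at a crossing with over-arc vector $y$ and upper under-arc vector $x$, the lower under-arc gets the vector $-(x\rhd^{\delta}y)$, where, for a right-handed crossing, $\delta=1$ if the over-arc is directed downward and $\delta=-1$ if it is directed upward, and the other way round for a left-handed crossing. The rep-polynomial $P_K(u)\in\mathbb Z[u]$ is $\pm\langle z,b\rangle$,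 where $z$ is the vector at the bottom of strand 3 if $k$ is odd and of strand 1 if $k$ is even, and the sign is chosen so that the leading coefficient is positive. Let $G(K)$ be the knot group. A homomorphism $\rho:G(K)\to SL(2,\mathbb C)$ is a non-abelian parabolic representation if its image is not commutative and $\operatorname{tr}\rho(\mu)=2$ for every meridian $\mu$; such representations are considered up to conjugation in $SL(2,\mathbb C)$. Then $u$ divides $P_K(u)$, and there is a 1-1 correspondence between the set $\{r^2 : r\in\mathbb C \text{ a root of } \tfrac1uP_K(u)\}$ and the set of conjugacy classes of non-abelian parabolic representations of $K$. Under it, $r^2$ corresponds to the class of the representation that maps the meridians of the two top arcs (those with the vectors $a$ and $b$, respectively) to $$\begin{pmatrix}1&1\\0&1\end{pmatrix},\qquad \begin{pmatrix}1&0\\-r^2&1\end{pmatrix}.$$ Moreover, write $\dfrac{1}{n_1+\frac{1}{n_2+\cdots+\frac1{n_k}}}=\dfrac{\beta_0}{\alpha}$ in lowest terms with $\alpha>0$ (intermediate values $\frac10=\infty$ being allowed), and let $\beta$ be any odd integer with $\beta\equiv\pm\beta_0\pmod\alpha$. Then $$\tfrac1uP_K(u)=\pm\mathcal R(u^2),$$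 where $\mathcal R(y)\in\mathbb Z[y]$ is the Riley polynomial of $S(\alpha,\beta)$, i.e. the upper left entry of $$A^{\epsilon_1}B^{\epsilon_2}A^{\epsilon_3}B^{\epsilon_4}\cdots A^{\epsilon_{\alpha-2}}B^{\epsilon_{\alpha-1}},\quad A=\begin{pmatrix}1&1\\0&1\end{pmatrix},\ B=\begin{pmatrix}1&0\\-y&1\end{pmatrix},\ \epsilon_i=-(-1)^{\lfloor i\beta/\alpha\rfloor}.$$ -/

import Mathlib

open Polynomial

namespace TwoBridge

/-- A crossing in a diagram made of four descending strands (numbered `0,1,2,3` from the left).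
It involves the strands at positions `pos` and `pos + 1`. It is right-handed if the over-strand
joins the upper right end to the lower left end, and left-handed if the over-strand joins the upper
left end to the lower right end. -/
structure Crossing where
  pos : Fin 3
  rightHanded : Bool

namespace Crossing

variable (c : Crossing)

/-- Position of the over-strand just above the crossing. -/
def overIn : Fin 4 := if c.rightHanded then c.pos.succ else c.pos.castSucc

/-- Position of the under-strand just above the crossing. -/
def underIn : Fin 4 := if c.rightHanded then c.pos.castSucc else c.pos.succ

/-- The position just below the crossing of the strand that is at `p` just above it. -/
def pass (p : Fin 4) : Fin 4 := Equiv.swap c.pos.castSucc c.pos.succ p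

end Crossing

/-- The crossings, from top to bottom, of the blocks with parameters `n`; the first of the blocks
lies in the middle (positions `1,2`) if `mid`, and on the left (positions `0,1`) otherwise, and the
following blocks alternate. A block with parameter `m` has `|m|` crossings; for `m > 0` they are
right-handed in the middle and left-handed on the left, for `m < 0` the other way round. -/
def blocks : (mid : Bool) → (n : List ℤ) → List Crossing
  | _, [] => []
  | true, m :: n => List.replicate m.natAbs ⟨1, decide (0 < m)⟩ ++ blocks false n
  | false, m :: n => List.replicate m.natAbs ⟨0, decide (m < 0)⟩ ++ blocks true n

/-- The crossings of the Conway diagram `C[n₁,…,n_k]`. -/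
def crossings (n : List ℤ) : List Crossing := blocks true n

/-- The pairs of positions joined by the two caps at the top. -/
def topCaps : List (Fin 4 × Fin 4) := [(0, 1), (2, 3)]

/-- The pairs of positions joined by the two caps at the bottom of `C[n₁,…,n_k]`. -/
def bottomCaps (n : List ℤ) : List (Fin 4 × Fin 4) :=
  if Odd n.length then [(0, 1), (2, 3)] else [(1, 2), (0, 3)]

/-- The segments of the diagram `C[n₁,…,n_k]`: `(t, p)` is the piece of strand at position `p`
between the crossings number `t - 1` and `t` (counted from `0`, from top to bottom). An arc of the
diagram is a union of consecutive segments. -/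
abbrev Segment (n : List ℤ) : Type := Fin ((crossings n).length + 1) × Fin 4

/-- The crossing number `t` of `C[n₁,…,n_k]`. -/
def crossing (n : List ℤ) (t : Fin (crossings n).length) : Crossing := (crossings n).get t

/-- Two segments follow each other along the link. -/
inductive Joined (n : List ℤ) : Segment n → Segment n → Prop
  | pass (t : Fin (crossings n).length) (p : Fin 4) :
      Joined n (t.castSucc, p) (t.succ, (crossing n t).pass p)
  | top (p q : Fin 4) (h : (p, q) ∈ topCaps) : Joined n (0, p) (0, q)
  | bottom (p q : Fin 4) (h : (p, q) ∈ bottomCaps n) :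
      Joined n (Fin.last _, p) (Fin.last _, q)

/-- `C[n₁,…,n_k]` is a knot: it has only one component. -/
def IsKnot (n : List ℤ) : Prop := ∀ s s' : Segment n, Relation.EqvGen (Joined n) s s'

/-- An orientation of the link `C[n₁,…,n_k]`: the direction of every segment, `1` for downward and
`-1` for upward, consistent along the link. -/
structure Orientation (n : List ℤ) where
  dir : Segment n → ℤˣ
  pass : ∀ (t : Fin (crossings n).length) (p : Fin 4),
    dir (t.succ, (crossing n t).pass p) = dir (t.castSucc, p)
  top : ∀ p q : Fin 4, (p, q) ∈ topCaps → dir (0, q) = -dir (0, p)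
  bottom : ∀ p q : Fin 4, (p, q) ∈ bottomCaps n →
    dir (Fin.last _, q) = -dir (Fin.last _, p)

/-- The exponent `δ` for which, at crossing number `t`, the lower under-arc is `α ▷^δ β`, where `α`
is the upper under-arc and `β` the over-arc. It depends on the side of the oriented over-arc on
which `α` lies: for a right-handed crossing it is `1` if `β` is directed downward and `-1` if `β` is
directed upward, and the other way round for a left-handed crossing. -/
def quandleSign {n : List ℤ} (o : Orientation n) (t : Fin (crossings n).length) : ℤˣ :=
  if (crossing n t).rightHanded then o.dir (t.castSucc, (crossing n t).overIn)
  else -o.dir (t.castSucc, (crossing n t).overIn)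

/-! ### The group of the link and its parabolic representations -/

/-- The Wirtinger relators: segments of the same arc give the same generator, and at a crossing
with upper under-arc `α`, lower under-arc `γ` and over-arc `β` one has `γ = β^{-δ} α β^{δ}`. -/
inductive WirtingerRelator (n : List ℤ) (o : Orientation n) : FreeGroup (Segment n) → Prop
  | top (p q : Fin 4) (h : (p, q) ∈ topCaps) :
      WirtingerRelator n o (FreeGroup.of (0, p) * (FreeGroup.of (0, q))⁻¹)
  | bottom (p q : Fin 4) (h : (p, q) ∈ bottomCaps n) :
      WirtingerRelator n o
        (FreeGroup.of (Fin.last _, p) * (FreeGroup.of (Fin.last _, q))⁻¹)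
  | same (t : Fin (crossings n).length) (p : Fin 4) (h : p ≠ (crossing n t).underIn) :
      WirtingerRelator n o
        (FreeGroup.of (t.succ, (crossing n t).pass p) * (FreeGroup.of (t.castSucc, p))⁻¹)
  | under (t : Fin (crossings n).length) :
      WirtingerRelator n o
        (FreeGroup.of (t.succ, (crossing n t).pass (crossing n t).underIn) *
          (FreeGroup.of (t.castSucc, (crossing n t).overIn) ^ (-(quandleSign o t : ℤ)) *
            FreeGroup.of (t.castSucc, (crossing n t).underIn) *
            FreeGroup.of (t.castSucc, (crossing n t).overIn) ^ (quandleSign o t : ℤ))⁻¹)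

/-- The link group of `C[n₁,…,n_k]`, by its Wirtinger presentation. -/
abbrev LinkGroup (n : List ℤ) (o : Orientation n) : Type :=
  PresentedGroup {r | WirtingerRelator n o r}

/-- The meridian of (the arc containing) a segment. -/
def meridian {n : List ℤ} (o : Orientation n) (s : Segment n) : LinkGroup n o :=
  PresentedGroup.of s

/-- `SL(2, ℂ)`. -/
abbrev SL2C : Type := Matrix.SpecialLinearGroup (Fin 2) ℂ

/-- Non-abelian parabolic representations: every meridian is mapped to a matrix of trace `2`, and
the image is not commutative. -/
def IsNonabelianParabolic {n : List ℤ} {o : Orientation n} (ρ : LinkGroup n o →* SL2C) : Prop :=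
  (∀ s : Segment n, (ρ (meridian o s) : Matrix (Fin 2) (Fin 2) ℂ).trace = 2) ∧
    ∃ g h : LinkGroup n o, ρ g * ρ h ≠ ρ h * ρ g

/-- The set of non-abelian parabolic representations. -/
abbrev NonabelianParabolicRep (n : List ℤ) (o : Orientation n) : Type :=
  {ρ : LinkGroup n o →* SL2C // IsNonabelianParabolic ρ}

/-- Conjugacy of representations. -/
def conjSetoid (n : List ℤ) (o : Orientation n) : Setoid (NonabelianParabolicRep n o) where
  r ρ ρ' := ∃ g : SL2C, ∀ x : LinkGroup n o, ρ'.1 x = g * ρ.1 x * g⁻¹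
  iseqv :=
    { refl := fun ρ => ⟨1, fun x => by simp⟩
      symm := by
        rintro ρ ρ' ⟨g, hg⟩
        exact ⟨g⁻¹, fun x => by rw [hg x]; group⟩
      trans := by
        rintro ρ ρ' ρ'' ⟨g, hg⟩ ⟨h, hh⟩
        exact ⟨h * g, fun x => by rw [hh x, hg x]; group⟩ }

/-- Non-abelian parabolic representations up to conjugation in `SL(2, ℂ)`. -/
abbrev NonabelianParabolicClass (n : List ℤ) (o : Orientation n) : Type :=
  Quotient (conjSetoid n o)

/-! ### Arc vectors and the rep-polynomial -/

/-- The symplectic form `⟨x, y⟩ = det (x, y)`. -/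
noncomputable def bracket (x y : Fin 2 → ℤ[X]) : ℤ[X] := x 0 * y 1 - x 1 * y 0

/-- The arc vectors at all levels, as vectors with entries in `ℤ[u]`, from the top to the bottom.
The top arcs get `a = (1, 0)` and `b = (0, u)`, so that `⟨a, b⟩ = u`. At a crossing the lower
under-arc gets `-(x ▷^δ y) = -(x + δ ⟨x, y⟩ y)`, where `x` is the vector of the upper under-arc and
`y` that of the over-arc. -/
noncomputable def arcVec {n : List ℤ} (o : Orientation n) (t : Fin ((crossings n).length + 1)) :
    Fin 4 → Fin 2 → ℤ[X] :=
  Fin.induction (motive := fun _ => Fin 4 → Fin 2 → ℤ[X])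
    ![![1, 0], ![1, 0], ![0, X], ![0, X]]
    (fun t v p =>
      let x := v (crossing n t).underIn
      let y := v (crossing n t).overIn
      if p = (crossing n t).pass (crossing n t).underIn then
        -(x + (((quandleSign o t : ℤ) : ℤ[X]) * bracket x y) • y)
      else v ((crossing n t).pass p)) t

/-- The bracket `⟨b_{k,f}, b⟩` (`k` odd) or `⟨a_{k,f}, b⟩` (`k` even) of two arc vectors at the
bottom of the diagram whose vanishing expresses the closing condition. The rightmost strand has the
vector `b` at all levels; for odd `k` the right strand of the last block is at position `2`, and for
even `k` the left strand of the last block is at position `0`. -/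
noncomputable def closingBracket {n : List ℤ} (o : Orientation n) : ℤ[X] :=
  if Odd n.length then bracket (arcVec o (Fin.last _) 2) (arcVec o (Fin.last _) 3)
  else bracket (arcVec o (Fin.last _) 0) (arcVec o (Fin.last _) 3)

/-- The rep-polynomial: the closing bracket, with the sign that makes the leading coefficient
positive. -/
noncomputable def repPoly {n : List ℤ} (o : Orientation n) : ℤ[X] :=
  if 0 < (closingBracket o).leadingCoeff then closingBracket o else -closingBracket o

/-! ### The slope and the Riley polynomial -/

/-- Numerator and denominator of `[n₁,…,n_k] = 1/(n₁ + 1/(n₂ + ⋯ + 1/n_k))`, computed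
projectively, so that the intermediate value `1/0 = ∞` is allowed:
`[] = 0/1` and `1/(m + p/q) = q/(m q + p)`. Numerator and denominator are coprime. -/
def slope : List ℤ → ℤ × ℤ
  | [] => (0, 1)
  | m :: n => ((slope n).2, m * (slope n).2 + (slope n).1)

/-- The matrix `((1, 1), (0, 1))`. -/
noncomputable def rileyA : Matrix.SpecialLinearGroup (Fin 2) ℤ[X] :=
  ⟨!![1, 1; 0, 1], by simp⟩

/-- The matrix `((1, 0), (-y, 1))`. -/
noncomputable def rileyB : Matrix.SpecialLinearGroup (Fin 2) ℤ[X] :=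
  ⟨!![1, 0; -X, 1], by simp⟩

/-- `ε_i = -(-1)^⌊iβ/α⌋` (integer division by a positive integer is the floor). -/
def rileyEps (α : ℕ) (β : ℤ) (i : ℕ) : ℤ := -((((i : ℤ) * β) / (α : ℤ)).negOnePow : ℤ)

/-- `W = A^{ε_1} B^{ε_2} A^{ε_3} ⋯ A^{ε_{α-2}} B^{ε_{α-1}}`. -/
noncomputable def rileyW (α : ℕ) (β : ℤ) : Matrix.SpecialLinearGroup (Fin 2) ℤ[X] :=
  ((List.range (α - 1)).map fun j =>
    (if Odd (j + 1) then rileyA else rileyB) ^ rileyEps α β (j + 1)).prod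

/-- The Riley polynomial of the knot `S(α, β)` (`α`, `β` odd): the upper left entry of `W`. -/
noncomputable def rileyPoly (α : ℕ) (β : ℤ) : ℤ[X] :=
  (rileyW α β : Matrix (Fin 2) (Fin 2) ℤ[X]) 0 0

end TwoBridge

/-! The matrix `parabolic x` is the inverse of the transvection along x. It does not see the sign of
x, and it turns the vector rule at a crossing into the Wirtinger relation. So the arc vectors at u =
r colour the whole diagram by matrices, and only the bottom caps can obstruct a representation. The
last strand always carries b, hence the closing bracket is u times the first coordinate z₀ of the
closing vector z. If z₀(r) = 0, then the triviality of the product of the four downward meridians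
closes both caps (`parabolic_bottom`).

Conversely, elements of trace 2 are of the form `parabolic x`, and a non-commuting pair can be
conjugated to the matrices of (1, 0) and (0, r); the closing relation then gives z₀(r) = 0
(`exists_conj_rootRep`). The trace 2 - r² of the product of the two top meridians recovers r². For a
knot z₀(0) ≠ 0 (`eval_zero_closing_ne_zero`): at u = 0 all arc vectors are ±a or 0, and z₀(0) = 0
would make this distinction a non-constant function on a single component. Hence no root is 0, and
the representations are non-abelian.

For the Riley polynomial, view each level as a sphere with four punctures, a quotient of the plane
with its integer lattice. The first three strands are meridians at the ends of lines of directions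
f, e + f, e, where (e, f) is a basis of the lattice; a crossing acts on this basis by an elementary
matrix (`FrameInvariant.step`). The blocks therefore run through a continued fraction, and the
closing meridian belongs to the line of slope ±β₀/α, up to conjugation by a power of B
(`closing_meridian`). The word read along this line is Riley's word up to a common sign of the
exponents. It carries a to ±z, so z₀ is, up to sign, its upper left entry (`closingPoly_riley`). -/

namespace TwoBridge

/-! ### Words along lattice segments and the product relation of a Farey triangle -/

section LatticeWords

variable {G : Type*} [Group G] (A B : G)

/-- The meridian of the lattice point `(x, m)`: the even columns carry `B`, the odd ones `A`, and
the direction alternates along a column. -/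
def latticeMeridian (x m : ℤ) : G := (if Odd x then A else B) ^ (m.negOnePow : ℤ)

theorem latticeMeridian_congr {x x' m m' : ℤ} (hx : Even (x - x')) (hm : Even (m - m')) :
    latticeMeridian A B x m = latticeMeridian A B x' m' := by
  have h1 : Odd x ↔ Odd x' := by grind
  have h2 : m.negOnePow = m'.negOnePow := (Int.negOnePow_eq_iff m m').2 hm
  simp only [latticeMeridian, h1, h2]

theorem latticeMeridian_eq_inv {x x' m m' : ℤ} (hx : Even (x - x')) (hm : Odd (m - m')) :
    latticeMeridian A B x m = (latticeMeridian A B x' m')⁻¹ := by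
  have h1 : Odd x ↔ Odd x' := by grind
  have h2 : m.negOnePow = -m'.negOnePow := by
    rw [← Int.negOnePow_succ, Int.negOnePow_eq_iff]
    grind
  simp only [latticeMeridian, h1, h2, Units.val_neg, zpow_neg]

/-- The word read off along the segment that starts at the lattice point `(x, m)` and has direction
`(a, b)`: every column crossed contributes the inverse of the meridian just below the segment. -/
def lineWord (x m : ℤ) (a : ℕ) (b : ℤ) : G :=
  ((List.range (a - 1)).map fun j =>
    (latticeMeridian A B (x + (j + 1 : ℕ)) (m + (j + 1 : ℕ) * b / a))⁻¹).prod

/-- The triangle with vertices 0, (a, b), (a + c, b + d) has determinant ±1, so it contains no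
lattice point besides its vertices; in the columns before a, its two sides from 0 lie above the same
lattice points. -/
theorem mul_add_ediv_add {a c i b d : ℤ} (ha : 0 < a) (hc : 0 < c)
    (hdet : a * d - b * c = 1 ∨ a * d - b * c = -1) (hi : 0 < i) (hia : i < a) :
    i * (b + d) / (a + c) = i * b / a := by
  have h1 := Int.emod_nonneg (i * b) ha.ne'
  have h2 := Int.emod_lt_of_pos (i * b) ha
  have h3 := Int.mul_ediv_add_emod (i * b) a
  set q := i * b / a
  set r := i * b % a
  have key : (i * (b + d) - q * (a + c)) * a = r * (a + c) + i * (a * d - b * c) := by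
    linear_combination (-(a + c)) * h3
  rw [Int.ediv_eq_iff_of_pos (by omega)]
  have lower : -1 < i * (b + d) - q * (a + c) := by
    refine lt_of_mul_lt_mul_right (a := a) ?_ ha.le
    rcases hdet with h | h <;> rw [key, h] <;> nlinarith
  have upper : i * (b + d) - q * (a + c) < a + c := by
    refine lt_of_mul_lt_mul_right (a := a) ?_ ha.le
    rcases hdet with h | h <;> rw [key, h] <;> nlinarith
  constructor <;> linarith

theorem add_mul_add_ediv_add {a c i b d : ℤ} (ha : 0 < a) (hc : 0 < c)
    (hdet : a * d - b * c = 1 ∨ a * d - b * c = -1) (hi : 0 < i) (hic : i < c) :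
    (a + i) * (b + d) / (a + c) = b + i * d / c := by
  have h1 := Int.emod_nonneg (i * d) hc.ne'
  have h2 := Int.emod_lt_of_pos (i * d) hc
  have h3 := Int.mul_ediv_add_emod (i * d) c
  set q := i * d / c
  set r := i * d % c
  have key : ((a + i) * (b + d) - (b + q) * (a + c)) * c =
      r * (a + c) + (c - i) * (a * d - b * c) := by
    linear_combination (-(a + c)) * h3
  rw [Int.ediv_eq_iff_of_pos (by omega)]
  have lower : -1 < (a + i) * (b + d) - (b + q) * (a + c) := by
    refine lt_of_mul_lt_mul_right (a := c) ?_ hc.le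
    rcases hdet with h | h <;> rw [key, h] <;> nlinarith
  have upper : (a + i) * (b + d) - (b + q) * (a + c) < a + c := by
    refine lt_of_mul_lt_mul_right (a := c) ?_ hc.le
    rcases hdet with h | h <;> rw [key, h] <;> nlinarith
  constructor <;> linarith

/-- A segment whose direction is the sum of a basis of the lattice is a concatenation. -/
theorem lineWord_add (x m : ℤ) {a c : ℕ} {b d : ℤ} (ha : 0 < a) (hc : 0 < c)
    (hdet : (a : ℤ) * d - b * c = 1 ∨ (a : ℤ) * d - b * c = -1) :
    lineWord A B x m (a + c) (b + d) = lineWord A B x m a b *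
      (latticeMeridian A B (x + a) (m + a * (b + d) / (a + c)))⁻¹ *
      lineWord A B (x + a) (m + b) c d := by
  obtain ⟨a', rfl⟩ : ∃ a', a = a' + 1 := ⟨a - 1, by omega⟩
  obtain ⟨c', rfl⟩ : ∃ c', c = c' + 1 := ⟨c - 1, by omega⟩
  unfold lineWord
  rw [show a' + 1 + (c' + 1) - 1 = a' + 1 + c' by omega, Nat.add_sub_cancel, Nat.add_sub_cancel,
    List.range_add, List.map_append, List.prod_append, List.range_succ, List.map_append,
    List.prod_append, List.map_map]
  congr 1
  · congr 1
    · congr 1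
      refine List.map_congr_left fun j hj => ?_
      have hj' := List.mem_range.1 hj
      have := mul_add_ediv_add (i := (j + 1 : ℕ)) (by exact_mod_cast ha) (by exact_mod_cast hc)
        hdet (by positivity) (by exact_mod_cast (by omega))
      push_cast at this ⊢
      rw [this]
    · simp
  · congr 1
    refine List.map_congr_left fun j hj => ?_
    have hj' := List.mem_range.1 hj
    have := add_mul_add_ediv_add (i := (j + 1 : ℕ)) (by exact_mod_cast ha) (by exact_mod_cast hc)
      hdet (by positivity) (by exact_mod_cast (by omega))
    simp only [Function.comp]
    push_cast at this ⊢
    rw [show (a' : ℤ) + 1 + j + 1 = a' + 1 + (j + 1) by ring, this]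
    simp only [add_assoc]

/-- The long segment passes just above the corner, so the corner itself contributes the extra
letter. -/
theorem lineWord_add_of_det_eq_one (x m : ℤ) {a c : ℕ} {b d : ℤ} (ha : 0 < a) (hc : 0 < c)
    (hdet : (a : ℤ) * d - b * c = 1) :
    lineWord A B x m (a + c) (b + d) = lineWord A B x m a b *
      (latticeMeridian A B (x + a) (m + b))⁻¹ * lineWord A B (x + a) (m + b) c d := by
  have h : (a : ℤ) * (b + d) / (a + c) = b := by
    rw [Int.ediv_eq_iff_of_pos (by omega)]
    constructor <;> nlinarith
  rw [lineWord_add A B x m ha hc (Or.inl hdet), h]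

/-- The long segment passes just below the corner; the lattice point under it is one lower, where
the meridian is the inverse of the one at the corner. -/
theorem lineWord_add_of_det_eq_neg_one (x m : ℤ) {a c : ℕ} {b d : ℤ} (ha : 0 < a) (hc : 0 < c)
    (hdet : (a : ℤ) * d - b * c = -1) :
    lineWord A B x m (a + c) (b + d) = lineWord A B x m a b *
      latticeMeridian A B (x + a) (m + b) * lineWord A B (x + a) (m + b) c d := by
  have h : (a : ℤ) * (b + d) / (a + c) = b - 1 := by
    rw [Int.ediv_eq_iff_of_pos (by omega)]
    constructor <;> nlinarith
  rw [lineWord_add A B x m ha hc (Or.inr hdet), h,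
    latticeMeridian_eq_inv A B (x := x + a) (x' := x + a) (m := m + (b - 1)) (m' := m + b)
      (by simp) (by ring_nf; decide), inv_inv]

/-- Reversing a segment: rotate it by `π` about its end point. -/
theorem lineWord_inv (x m : ℤ) {a : ℕ} {b : ℤ} (hab : IsCoprime (a : ℤ) b) :
    (lineWord A B x m a b)⁻¹ = lineWord A B (x + a) (m + b) a b := by
  unfold lineWord
  rw [List.prod_inv_reverse, List.map_map, ← List.map_reverse]
  congr 1
  apply List.ext_getElem (by simp)
  intro j h1 h2
  have hj : j < a - 1 := by simpa using h2
  simp only [List.getElem_map, List.getElem_reverse, List.length_range, List.getElem_range,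
    Function.comp]
  obtain ⟨i, hi⟩ : ∃ i, a = j + 1 + (i + 1) := ⟨a - 1 - 1 - j, by omega⟩
  rw [show a - 1 - 1 - j = i by omega, inv_inv]
  -- Coprimality keeps lattice points out of the interior of the segment, so reflecting the height
  -- turns the floor q into b - 1 - q. The parity changes accordingly and the meridian is inverted.
  have key : ((i + 1 : ℕ) : ℤ) * b / a = b - 1 - (j + 1 : ℕ) * b / a := by
    have ha : (0 : ℤ) < a := by omega
    have h1 := Int.emod_nonneg ((j + 1 : ℕ) * b) ha.ne'
    have h2 := Int.emod_lt_of_pos ((j + 1 : ℕ) * b) ha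
    have h3 := Int.mul_ediv_add_emod ((j + 1 : ℕ) * b) a
    have h4 : ((j + 1 : ℕ) : ℤ) * b % a ≠ 0 := by
      intro h0
      have := Int.le_of_dvd (by positivity) (hab.dvd_of_dvd_mul_right (Int.dvd_of_emod_eq_zero h0))
      omega
    have h5 : (a : ℤ) = (j + 1 : ℕ) + (i + 1 : ℕ) := by exact_mod_cast hi
    have h6 : ((i + 1 : ℕ) : ℤ) * b =
        a * (b - ((j + 1 : ℕ) : ℤ) * b / a) - ((j + 1 : ℕ) : ℤ) * b % a := by
      linear_combination h3 - b * h5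
    rw [Int.ediv_eq_iff_of_pos ha, h6]
    constructor <;> nlinarith [lt_of_le_of_ne h1 h4.symm]
  rw [key]
  apply latticeMeridian_eq_inv
  · rw [show x + ((i + 1 : ℕ) : ℤ) - (x + a + ((j + 1 : ℕ) : ℤ)) = -(2 * (j + 1)) by
      rw [hi]; push_cast; ring]
    simp
  · rw [show ∀ q : ℤ, m + (b - 1 - q) - (m + b + q) = -(2 * q + 1) by intro q; ring]
    exact (odd_two_mul_add_one _).neg

/-- The meridian of the end point of the segment from the origin to `(a, b)`, with the segment as
its tail. -/
def arcMeridian (a : ℕ) (b : ℤ) : G :=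
  lineWord A B 0 0 a b * latticeMeridian A B a b * (lineWord A B 0 0 a b)⁻¹

theorem lineWord_of_le_one (x m : ℤ) {a : ℕ} (ha : a ≤ 1) (b : ℤ) : lineWord A B x m a b = 1 := by
  simp [lineWord, Nat.sub_eq_zero_of_le ha]

theorem arcMeridian_zero {b : ℤ} (hb : Odd b) : arcMeridian A B 0 b = B⁻¹ := by
  simp [arcMeridian, lineWord_of_le_one, latticeMeridian, Int.negOnePow_odd _ hb]

theorem arcMeridian_one_even {b : ℤ} (hb : Even b) : arcMeridian A B 1 b = A := by
  simp [arcMeridian, lineWord_of_le_one, latticeMeridian, Int.negOnePow_even _ hb]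

theorem arcMeridian_one_odd {b : ℤ} (hb : Odd b) : arcMeridian A B 1 b = A⁻¹ := by
  simp [arcMeridian, lineWord_of_le_one, latticeMeridian, Int.negOnePow_odd _ hb]

theorem arcMeridian_one_mul (b : ℤ) : arcMeridian A B 1 b * arcMeridian A B 1 (b + 1) = 1 := by
  rcases Int.even_or_odd b with h | h
  · rw [arcMeridian_one_even A B h, arcMeridian_one_odd A B (by grind), mul_inv_cancel]
  · rw [arcMeridian_one_odd A B h, arcMeridian_one_even A B (by grind), inv_mul_cancel]

/-- `w = u + v`, and `u = (a, b)` is steeper than `v = (c, d)`. -/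
theorem arcMeridian_add_left {a c : ℕ} {b d : ℤ} (ha : 0 < a) (hc : 0 < c)
    (hdet : b * c - a * d = 1) :
    arcMeridian A B (a + c + a) (b + d + b) =
      (arcMeridian A B (a + c) (b + d))⁻¹ * arcMeridian A B c d *
        arcMeridian A B (a + c) (b + d) := by
  -- Both w + u and w = v + u end with a step along u. A half turn about w makes these two steps
  -- inverse to each other, so the step can be eliminated; the end points w + u and v differ by 2u
  -- and carry the same meridian.
  have e1 := lineWord_add_of_det_eq_one A B 0 0 (a := a + c) (c := a) (b := b + d) (d := b)
    (by omega) ha (by push_cast; linear_combination hdet)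
  have e2 := lineWord_add_of_det_eq_one A B 0 0 (a := c) (c := a) (b := d) (d := b)
    hc ha (by linear_combination hdet)
  have e3 := lineWord_inv A B c d (a := a) (b := b) ⟨-d, c, by linear_combination hdet⟩
  have e4 : latticeMeridian A B ((a + c + a : ℕ) : ℤ) (b + d + b) = latticeMeridian A B c d :=
    latticeMeridian_congr A B (by push_cast; ring_nf; simp) (by ring_nf; simp)
  unfold arcMeridian
  rw [e4]
  simp only [zero_add] at e1 e2
  rw [Nat.add_comm c a, add_comm d b] at e2
  rw [show (c : ℤ) + a = ((a + c : ℕ) : ℤ) by push_cast; ring, add_comm d b] at e3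
  rw [e1, ← e3, e2]
  group

theorem arcMeridian_add_right {a c : ℕ} {b d : ℤ} (ha : 0 < a) (hc : 0 < c)
    (hdet : b * c - a * d = 1) :
    arcMeridian A B (a + c + c) (b + d + d) =
      arcMeridian A B (a + c) (b + d) * arcMeridian A B a b *
        (arcMeridian A B (a + c) (b + d))⁻¹ := by
  have e1 := lineWord_add_of_det_eq_neg_one A B 0 0 (a := a + c) (c := c) (b := b + d) (d := d)
    (by omega) hc (by push_cast; linear_combination -hdet)
  have e2 := lineWord_add_of_det_eq_neg_one A B 0 0 (a := a) (c := c) (b := b) (d := d)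
    ha hc (by linear_combination -hdet)
  have e3 := lineWord_inv A B a b (a := c) (b := d) ⟨b, -a, by linear_combination hdet⟩
  have e4 : latticeMeridian A B ((a + c + c : ℕ) : ℤ) (b + d + d) = latticeMeridian A B a b :=
    latticeMeridian_congr A B (by push_cast; ring_nf; simp) (by ring_nf; simp)
  unfold arcMeridian
  rw [e4]
  simp only [zero_add] at e1 e2
  rw [show (a : ℤ) + c = ((a + c : ℕ) : ℤ) by push_cast; ring] at e3
  rw [e1, ← e3, e2]
  group

theorem arcMeridian_two (d : ℤ) :
    arcMeridian A B 1 d * arcMeridian A B 2 (d + 1 + d) * arcMeridian A B 1 (d + 1) * B = 1 := by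
  have e1 := lineWord_add_of_det_eq_neg_one A B 0 0 (a := 1) (c := 1) (b := d + 1) (d := d)
    (by omega) (by omega) (by push_cast; ring)
  have e2 : latticeMeridian A B 2 (d + 1 + d) = B⁻¹ := by
    simp [latticeMeridian, Int.negOnePow_odd (d + 1 + d) (by grind)]
  have e3 := arcMeridian_one_mul A B d
  have e4 : arcMeridian A B 1 (d + 1) = latticeMeridian A B 1 (d + 1) := by
    simp [arcMeridian, lineWord_of_le_one]
  rw [lineWord_of_le_one A B _ _ le_rfl, lineWord_of_le_one A B _ _ le_rfl] at e1
  simp only [zero_add, one_mul, mul_one, Nat.cast_one] at e1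
  have e5 : arcMeridian A B 2 (d + 1 + d) =
      arcMeridian A B 1 (d + 1) * B⁻¹ * (arcMeridian A B 1 (d + 1))⁻¹ := by
    rw [e4, ← e1, ← e2]
    rfl
  rw [e5, ← mul_assoc, ← mul_assoc, e3]
  group

/-- The product relation for the three lines of a Farey triangle. -/
theorem arcMeridian_farey : ∀ (N a c : ℕ) (b d : ℤ), a + c ≤ N → b * c - a * d = 1 →
    arcMeridian A B c d * arcMeridian A B (a + c) (b + d) * arcMeridian A B a b * B = 1
  | 0, a, c, b, d, hN, hdet => by
    obtain ⟨rfl, rfl⟩ : a = 0 ∧ c = 0 := by omega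
    simp at hdet
  | N + 1, a, c, b, d, hN, hdet => by
    rcases Nat.eq_zero_or_pos a with rfl | ha
    · have hc : c = 1 := by
        have : (c : ℤ) ∣ 1 := ⟨b, by linear_combination -hdet⟩
        exact Nat.dvd_one.1 (by exact_mod_cast this)
      subst hc
      obtain rfl : b = 1 := by simpa using hdet
      rw [arcMeridian_zero A B odd_one, Nat.zero_add, add_comm 1 d, arcMeridian_one_mul]
      group
    rcases Nat.eq_zero_or_pos c with rfl | hc
    · have ha : a = 1 := by
        have : (a : ℤ) ∣ 1 := ⟨-d, by linear_combination -hdet⟩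
        exact Nat.dvd_one.1 (by exact_mod_cast this)
      subst ha
      obtain rfl : d = -1 := by
        simp at hdet
        omega
      have := arcMeridian_one_mul A B (b + -1)
      rw [neg_add_cancel_right] at this
      rw [arcMeridian_zero A B (by decide), mul_assoc B⁻¹, this]
      group
    rcases lt_trichotomy a c with h | h | h
    · obtain ⟨c, rfl⟩ : ∃ c', c = a + c' := ⟨c - a, by omega⟩
      obtain ⟨d, rfl⟩ : ∃ d', d = b + d' := ⟨d - b, by ring⟩
      have hdet' : b * c - a * d = 1 := by push_cast at hdet; linear_combination hdet
      have ih := arcMeridian_farey N a c b d (by omega) hdet'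
      have := arcMeridian_add_left A B ha (c := c) (d := d) (by omega) hdet'
      rw [show a + (a + c) = a + c + a by ring, show b + (b + d) = b + d + b by ring, this]
      rw [← ih]
      group
    · subst h
      have ha : a = 1 := by
        have : (a : ℤ) ∣ 1 := ⟨b - d, by linear_combination -hdet⟩
        exact Nat.dvd_one.1 (by exact_mod_cast this)
      subst ha
      obtain rfl : b = d + 1 := by
        simp at hdet
        omega
      exact arcMeridian_two A B d
    · obtain ⟨a, rfl⟩ : ∃ a', a = a' + c := ⟨a - c, by omega⟩
      obtain ⟨b, rfl⟩ : ∃ b', b = b' + d := ⟨b - d, by ring⟩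
      have hdet' : b * c - a * d = 1 := by push_cast at hdet; linear_combination hdet
      have ih := arcMeridian_farey N a c b d (by omega) hdet'
      have := arcMeridian_add_right A B (a := a) (b := b) (by omega) hc hdet'
      rw [this, ← ih]
      group

end LatticeWords
-- Frames of directions and the action of a crossing on them
section Frames

variable {G : Type*} [Group G] (A B : G)

/-- The meridian of the end point of the line of direction `± v`. -/
def lineMeridian (v : ℤ × ℤ) : G :=
  if 0 ≤ v.1 then arcMeridian A B v.1.natAbs v.2 else arcMeridian A B v.1.natAbs (-v.2)

theorem lineMeridian_of_nonneg {v : ℤ × ℤ} (h : 0 ≤ v.1) :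
    lineMeridian A B v = arcMeridian A B v.1.natAbs v.2 := if_pos h

theorem lineMeridian_of_fst_eq_zero {v : ℤ × ℤ} (h : v.1 = 0) (h' : Odd v.2) :
    lineMeridian A B v = B⁻¹ := by
  rw [lineMeridian_of_nonneg A B h.ge, h, Int.natAbs_zero, arcMeridian_zero A B h']

theorem lineMeridian_neg {v : ℤ × ℤ} (h : v.1 = 0 → Odd v.2) :
    lineMeridian A B (-v) = lineMeridian A B v := by
  by_cases h0 : v.1 = 0
  · rw [lineMeridian_of_fst_eq_zero A B h0 (h h0),
      lineMeridian_of_fst_eq_zero A B (by simp [h0]) (by simpa using h h0)]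
  · simp only [lineMeridian, Prod.fst_neg, Prod.snd_neg, Int.natAbs_neg, neg_neg]
    split_ifs <;> first | rfl | omega

/-- Whether the directions `v` and `w` lie in opposite half-planes. -/
def halfTurn (v w : ℤ × ℤ) : ℤ := if v.1 * w.1 < 0 then 1 else 0

theorem halfTurn_neg (v w : ℤ × ℤ) : halfTurn (-v) (-w) = halfTurn v w := by
  simp [halfTurn]

/-- Conjugation by a power of `B`. -/
def twist (j : ℤ) (x : G) : G := B ^ j * x * B ^ (-j)

theorem twist_twist (i j : ℤ) (x : G) : twist B i (twist B j x) = twist B (i + j) x := by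
  unfold twist; group

theorem twist_zero (x : G) : twist B 0 x = x := by simp [twist]

theorem twist_inv_self (j : ℤ) : twist B j B⁻¹ = B⁻¹ := by unfold twist; group

theorem twist_lineMeridian_of_fst_eq_zero {v : ℤ × ℤ} (h : v.1 = 0) (h' : Odd v.2) (i j : ℤ) :
    twist B i (lineMeridian A B v) = twist B j (lineMeridian A B v) := by
  rw [lineMeridian_of_fst_eq_zero A B h h', twist_inv_self, twist_inv_self]

theorem odd_snd_of_det {e f : ℤ × ℤ} (h : e.2 * f.1 - e.1 * f.2 = 1) :
    (e.1 = 0 → Odd e.2) ∧ (f.1 = 0 → Odd f.2) := by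
  constructor <;> intro h0
  · have : e.2 ∣ 1 := ⟨f.1, by linear_combination -h - f.2 * h0⟩
    rcases Int.isUnit_iff.1 (isUnit_of_dvd_one this) with h | h <;> rw [h] <;> decide
  · have : f.2 ∣ 1 := ⟨-e.1, by linear_combination -h + e.2 * h0⟩
    rcases Int.isUnit_iff.1 (isUnit_of_dvd_one this) with h | h <;> rw [h] <;> decide

/-- A cyclic rotation of the three lines costs a conjugation by B; this is the source of the
exponents `halfTurn`. -/
theorem rotate_relation {x y z : G} (h : x * y * z * B = 1) :
    y * z * (B * x * B⁻¹) * B = 1 :=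
  calc _ = x⁻¹ * (x * y * z * B) * x := by group
    _ = 1 := by rw [h]; group

theorem lineMeridian_farey_of_nonneg {e f : ℤ × ℤ} (h : e.2 * f.1 - e.1 * f.2 = 1)
    (hf : 0 ≤ f.1) :
    lineMeridian A B f * twist B (halfTurn (e + f) f) (lineMeridian A B (e + f)) *
      twist B (halfTurn e f) (lineMeridian A B e) * B = 1 := by
  obtain ⟨a, b⟩ := e
  obtain ⟨c, d⟩ := f
  rw [show (a, b) + (c, d) = (a + c, b + d) from rfl]
  simp only at h hf
  rcases le_or_gt 0 a with ha | ha
  · have := arcMeridian_farey A B _ a.natAbs c.natAbs b d le_rfl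
      (by rw [Int.natAbs_of_nonneg ha, Int.natAbs_of_nonneg hf]; exact h)
    have h1 : ¬ (a + c) * c < 0 := not_lt.2 (by positivity)
    have h2 : ¬ a * c < 0 := not_lt.2 (by positivity)
    simp only [halfTurn, h1, h2, if_false, twist_zero]
    rw [lineMeridian_of_nonneg A B hf, lineMeridian_of_nonneg A B (v := (a, b)) ha,
      lineMeridian_of_nonneg A B (add_nonneg ha hf)]
    rw [← Int.natAbs_add_of_nonneg ha hf] at this
    exact this
  have ea : lineMeridian A B (a, b) = arcMeridian A B a.natAbs (-b) := if_neg (not_le.2 ha)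
  rcases hf.lt_or_eq with hc | rfl
  · have hj : halfTurn (a, b) (c, d) = 1 := if_pos (mul_neg_of_neg_of_pos ha hc)
    -- Now -e points to the right. The Farey triangle in the right half-plane is spanned by e + f
    -- and -e, with sum f, or by f and -(e + f), with sum -e; one or two rotations bring its
    -- relation into the required order.
    rcases le_or_gt 0 (a + c) with hac | hac
    · have := arcMeridian_farey A B _ (a + c).natAbs a.natAbs (b + d) (-b) le_rfl (by
        rw [Int.natAbs_of_nonneg hac, Int.ofNat_natAbs_of_nonpos ha.le]; linear_combination h)
      have h1 : halfTurn (a + c, b + d) (c, d) = 0 := if_neg (not_lt.2 (by positivity))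
      rw [show (a + c).natAbs + a.natAbs = c.natAbs by omega, show b + d + -b = d by ring] at this
      rw [h1, hj, ea, lineMeridian_of_nonneg A B hf, lineMeridian_of_nonneg A B hac, twist_zero]
      simpa only [twist, zpow_one, zpow_neg] using rotate_relation B this
    · have := arcMeridian_farey A B _ c.natAbs (a + c).natAbs d (-(b + d)) le_rfl (by
        rw [Int.natAbs_of_nonneg hf, Int.ofNat_natAbs_of_nonpos hac.le]; linear_combination h)
      have h1 : halfTurn (a + c, b + d) (c, d) = 1 := if_pos (mul_neg_of_neg_of_pos hac hc)
      have eac : lineMeridian A B (a + c, b + d) = arcMeridian A B (a + c).natAbs (-(b + d)) :=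
        if_neg (not_le.2 hac)
      rw [show c.natAbs + (a + c).natAbs = a.natAbs by omega,
        show d + -(b + d) = -b by ring] at this
      rw [h1, hj, ea, eac, lineMeridian_of_nonneg A B hf]
      have h2 := rotate_relation B (rotate_relation B this)
      simp only [twist, zpow_one, zpow_neg]
      exact h2
  · have := arcMeridian_farey A B _ a.natAbs 0 (-b) (-d) le_rfl (by
        rw [Int.ofNat_natAbs_of_nonpos ha.le]; linear_combination h)
    have hd : Odd d := (odd_snd_of_det (e := (a, b)) (f := (0, d)) h).2 rfl
    have eac : lineMeridian A B (a + 0, b + d) = arcMeridian A B a.natAbs (-b + -d) := by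
      rw [add_zero, ← neg_add]
      exact if_neg (not_le.2 ha)
    simp only [halfTurn, mul_zero, lt_irrefl, if_false, twist_zero]
    rw [arcMeridian_zero A B hd.neg] at this
    rw [lineMeridian_of_fst_eq_zero A B rfl hd, ea, eac]
    exact this

theorem lineMeridian_farey {e f : ℤ × ℤ} (h : e.2 * f.1 - e.1 * f.2 = 1) :
    lineMeridian A B f * twist B (halfTurn (e + f) f) (lineMeridian A B (e + f)) *
      twist B (halfTurn e f) (lineMeridian A B e) * B = 1 := by
  rcases le_or_gt 0 f.1 with hf | hf
  · exact lineMeridian_farey_of_nonneg A B h hf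
  · have h' := (odd_snd_of_det (e := e) (f := e + f)
      (by simp only [Prod.fst_add, Prod.snd_add]; linear_combination h)).2
    have := lineMeridian_farey_of_nonneg A B (e := -e) (f := -f)
      (by simp only [Prod.fst_neg, Prod.snd_neg]; linear_combination h)
      (by simp only [Prod.fst_neg]; omega)
    rwa [← neg_add, halfTurn_neg, halfTurn_neg, lineMeridian_neg A B (odd_snd_of_det h).1,
      lineMeridian_neg A B (odd_snd_of_det h).2, lineMeridian_neg A B h'] at this

/-- The preceding relation conjugated by a power of B, so that e instead of f is untwisted. The half
turns from e to e + f and from e + f to f add up, unless e + f is vertical; then its meridian is B⁻¹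
and the twist does not matter. -/
theorem lineMeridian_farey' {e f : ℤ × ℤ} (h : e.2 * f.1 - e.1 * f.2 = 1) :
    twist B (-halfTurn e f) (lineMeridian A B f) *
      twist B (-halfTurn e (e + f)) (lineMeridian A B (e + f)) * lineMeridian A B e * B = 1 := by
  have h' := (odd_snd_of_det (e := e) (f := e + f)
    (by simp only [Prod.fst_add, Prod.snd_add]; linear_combination h)).2
  have e1 : twist B (-halfTurn e (e + f)) (lineMeridian A B (e + f)) =
      twist B (-halfTurn e f + halfTurn (e + f) f) (lineMeridian A B (e + f)) := by
    by_cases h0 : (e + f).1 = 0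
    · exact twist_lineMeridian_of_fst_eq_zero A B h0 (h' h0) _ _
    · congr 1
      simp only [halfTurn, Prod.fst_add] at h0 ⊢
      rcases lt_trichotomy e.1 0 with h1 | h1 | h1 <;>
        rcases lt_trichotomy f.1 0 with h2 | h2 | h2 <;>
        rcases lt_or_gt_of_ne h0 with h3 | h3 <;>
        first
          | omega
          | simp [mul_self_nonneg, mul_pos_of_neg_of_neg, mul_neg_of_neg_of_pos,
              mul_neg_of_pos_of_neg, not_lt_of_gt, h1, h2, h3]
  have := lineMeridian_farey A B h
  rw [e1, ← twist_twist]
  set j := halfTurn e f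
  calc _ = B ^ (-j) * (lineMeridian A B f *
        twist B (halfTurn (e + f) f) (lineMeridian A B (e + f)) *
        twist B j (lineMeridian A B e) * B) * B ^ j := by
        simp only [twist]; group
    _ = 1 := by rw [this]; group

/-- The downward meridians `x p` of the four strands at some level are those of the lines of
directions `f`, `e + f` and `e`, up to a common power of the meridian of the last strand. -/
structure FrameInvariant (s : (ℤ × ℤ) × (ℤ × ℤ)) (x : Fin 4 → G) : Prop where
  det : s.1.2 * s.2.1 - s.1.1 * s.2.2 = 1
  last : x 3 = B
  prod : x 0 * x 1 * x 2 * B = 1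
  lines : ∃ j, x 0 = twist B j (lineMeridian A B s.2) ∧
    x 2 = twist B (j + halfTurn s.1 s.2) (lineMeridian A B s.1)

/-- The product relation determines each of three meridians from the other two, and it is compatible
with twisting because B commutes with its own powers. -/
theorem middle_of_relations {x0 x1 x2 y0 y1 y2 : G} {j : ℤ} (hx : x0 * x1 * x2 * B = 1)
    (hy : y0 * y1 * y2 * B = 1) (h0 : x0 = twist B j y0) (h2 : x2 = twist B j y2) :
    x1 = twist B j y1 := by
  have ex : x1 = x0⁻¹ * B⁻¹ * x2⁻¹ := by
    rw [eq_mul_inv_iff_mul_eq, eq_mul_inv_iff_mul_eq, eq_comm, inv_eq_iff_mul_eq_one]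
    simpa only [mul_assoc] using hx
  have ey : y1 = y0⁻¹ * B⁻¹ * y2⁻¹ := by
    rw [eq_mul_inv_iff_mul_eq, eq_mul_inv_iff_mul_eq, eq_comm, inv_eq_iff_mul_eq_one]
    simpa only [mul_assoc] using hy
  rw [ex, ey, h0, h2]
  simp only [twist]
  group

theorem right_of_relations {x0 x1 x2 y0 y1 y2 : G} {j : ℤ} (hx : x0 * x1 * x2 * B = 1)
    (hy : y0 * y1 * y2 * B = 1) (h0 : x0 = twist B j y0) (h1 : x1 = twist B j y1) :
    x2 = twist B j y2 := by
  have ex : x2 = x1⁻¹ * x0⁻¹ * B⁻¹ := by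
    rw [eq_mul_inv_iff_mul_eq, eq_inv_mul_iff_mul_eq, eq_comm, inv_eq_iff_mul_eq_one]
    simpa only [mul_assoc] using hx
  have ey : y2 = y1⁻¹ * y0⁻¹ * B⁻¹ := by
    rw [eq_mul_inv_iff_mul_eq, eq_inv_mul_iff_mul_eq, eq_comm, inv_eq_iff_mul_eq_one]
    simpa only [mul_assoc] using hy
  rw [ex, ey, h0, h1]
  simp only [twist]
  group

theorem left_of_relations {x0 x1 x2 y0 y1 y2 : G} {j : ℤ} (hx : x0 * x1 * x2 * B = 1)
    (hy : y0 * y1 * y2 * B = 1) (h1 : x1 = twist B j y1) (h2 : x2 = twist B j y2) :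
    x0 = twist B j y0 := by
  have ex : x0 = B⁻¹ * x2⁻¹ * x1⁻¹ := by
    rw [eq_mul_inv_iff_mul_eq, eq_mul_inv_iff_mul_eq, eq_inv_iff_mul_eq_one, hx]
  have ey : y0 = B⁻¹ * y2⁻¹ * y1⁻¹ := by
    rw [eq_mul_inv_iff_mul_eq, eq_mul_inv_iff_mul_eq, eq_inv_iff_mul_eq_one, hy]
  rw [ex, ey, h1, h2]
  simp only [twist]
  group

variable {A B}

/-- The middle line, seen from the leftmost strand. -/
theorem FrameInvariant.middle_left {s : (ℤ × ℤ) × (ℤ × ℤ)} {x : Fin 4 → G}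
    (h : FrameInvariant A B s x) : ∃ j, x 0 = twist B j (lineMeridian A B s.2) ∧
      x 1 = twist B (j + halfTurn (s.1 + s.2) s.2) (lineMeridian A B (s.1 + s.2)) ∧
      x 2 = twist B (j + halfTurn s.1 s.2) (lineMeridian A B s.1) := by
  obtain ⟨j, h0, h2⟩ := h.lines
  refine ⟨j, h0, ?_, h2⟩
  rw [← twist_twist] at h2 ⊢
  exact middle_of_relations B h.prod (lineMeridian_farey A B h.det) h0 h2

/-- The lines, seen from the strand at position `2`. -/
theorem FrameInvariant.middle_right {s : (ℤ × ℤ) × (ℤ × ℤ)} {x : Fin 4 → G}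
    (h : FrameInvariant A B s x) :
    ∃ j, x 0 = twist B (j - halfTurn s.1 s.2) (lineMeridian A B s.2) ∧
      x 1 = twist B (j - halfTurn s.1 (s.1 + s.2)) (lineMeridian A B (s.1 + s.2)) ∧
      x 2 = twist B j (lineMeridian A B s.1) := by
  obtain ⟨j, h0, h2⟩ := h.lines
  refine ⟨j + halfTurn s.1 s.2, by simpa using h0, ?_, h2⟩
  rw [sub_eq_add_neg, ← twist_twist]
  refine middle_of_relations B h.prod (lineMeridian_farey' A B h.det) ?_ h2
  rw [twist_twist]
  simpa using h0

theorem frameInvariant_start {x : Fin 4 → G} (h1 : x 0 = A) (h2 : x 1 = A⁻¹) (h3 : x 2 = B⁻¹)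
    (h4 : x 3 = B) : FrameInvariant A B ((0, 1), (1, 0)) x where
  det := by simp
  last := h4
  prod := by rw [h1, h2, h3]; group
  lines := by
    refine ⟨0, ?_, ?_⟩
    · rw [twist_zero, h1, lineMeridian_of_nonneg A B (by simp)]
      exact (arcMeridian_one_even A B (by simp)).symm
    · rw [h3, lineMeridian_of_fst_eq_zero A B rfl odd_one, twist_inv_self]

/-- The action of a crossing on the downward meridians of the four strands. -/
def hurwitzStep (c : Crossing) (x : Fin 4 → G) (p : Fin 4) : G :=
  if p = c.pass c.underIn then
    if c.rightHanded then (x c.overIn)⁻¹ * x c.underIn * x c.overIn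
    else x c.overIn * x c.underIn * (x c.overIn)⁻¹
  else x (c.pass p)

/-- The action of a crossing on the frame of directions. -/
def frameStep (s : (ℤ × ℤ) × (ℤ × ℤ)) (c : Crossing) : (ℤ × ℤ) × (ℤ × ℤ) :=
  if c.pos = 1 then if c.rightHanded then (s.1 - s.2, s.2) else (s.1 + s.2, s.2)
  else if c.rightHanded then (s.1, s.2 + s.1) else (s.1, s.2 - s.1)

/-- A crossing conjugates one meridian and at most moves the others. The latter already belong to
lines of the new frame; if the conjugated one lands at position 0 or 2, the product relation
identifies it. -/
theorem FrameInvariant.step {s : (ℤ × ℤ) × (ℤ × ℤ)} {x : Fin 4 → G} (h : FrameInvariant A B s x)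
    {c : Crossing} (hc : c.pos ≠ 2) : FrameInvariant A B (frameStep s c) (hurwitzStep c x) := by
  obtain ⟨e, f⟩ := s
  obtain ⟨pos, r⟩ := c
  have hdet := h.det
  have hprod := h.prod
  have hlast := h.last
  simp only at hdet
  fin_cases pos
  · obtain ⟨j, h0, h1, h2⟩ := h.middle_right
    cases r
    · have hprod' : x 0 * x 1 * (x 0)⁻¹ * x 0 * x 2 * B = 1 := by rw [← hprod]; group
      have hdet' : e.2 * (f - e).1 - e.1 * (f - e).2 = 1 := by
        simp only [Prod.fst_sub, Prod.snd_sub]; linear_combination hdet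
      refine ⟨hdet', hlast, hprod', j - halfTurn e (f - e), ?_, ?_⟩
      swap
      · change x 2 = twist B (j - halfTurn e (f - e) + halfTurn e (f - e)) (lineMeridian A B e)
        rwa [sub_add_cancel]
      have hf := lineMeridian_farey' A B hdet'
      rw [add_sub_cancel] at hf
      rw [sub_eq_add_neg, ← twist_twist]
      rw [sub_eq_add_neg, ← twist_twist] at h0
      exact left_of_relations B hprod' hf h0 h2
    · have hdet' : e.2 * (f + e).1 - e.1 * (f + e).2 = 1 := by
        simp only [Prod.fst_add, Prod.snd_add]; linear_combination hdet
      refine ⟨hdet', hlast, ?_, j - halfTurn e (f + e), ?_, ?_⟩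
      · change x 1 * ((x 1)⁻¹ * x 0 * x 1) * x 2 * B = 1
        rw [← hprod]; group
      · rwa [add_comm e f] at h1
      · change x 2 = twist B (j - halfTurn e (f + e) + halfTurn e (f + e)) (lineMeridian A B e)
        rwa [sub_add_cancel]
  · obtain ⟨j, h0, h1, h2⟩ := h.middle_left
    cases r
    · have hdet' : (e + f).2 * f.1 - (e + f).1 * f.2 = 1 := by
        simp only [Prod.fst_add, Prod.snd_add]; linear_combination hdet
      refine ⟨hdet', hlast, ?_, j, h0, h1⟩
      · change x 0 * (x 1 * x 2 * (x 1)⁻¹) * x 1 * B = 1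
        rw [← hprod]; group
    · have hprod' : x 0 * x 2 * ((x 2)⁻¹ * x 1 * x 2) * B = 1 := by rw [← hprod]; group
      have hdet' : (e - f).2 * f.1 - (e - f).1 * f.2 = 1 := by
        simp only [Prod.fst_sub, Prod.snd_sub]; linear_combination hdet
      refine ⟨hdet', hlast, hprod', j, h0, ?_⟩
      have hf := lineMeridian_farey A B hdet'
      rw [sub_add_cancel] at hf
      change (x 2)⁻¹ * x 1 * x 2 = twist B (j + halfTurn (e - f) f) (lineMeridian A B (e - f))
      rw [← twist_twist]
      rw [← twist_twist] at h2
      exact right_of_relations B hprod' hf h0 h2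
  · exact absurd rfl hc

end Frames

/-! ### Blocks of crossings and the continued fraction -/

theorem crossings_pos_ne_two (n : List ℤ) : ∀ mid, ∀ c ∈ blocks mid n, c.pos ≠ 2 := by
  induction n with
  | nil => intro mid c hc; cases mid <;> simp [blocks] at hc
  | cons m n ih =>
    intro mid c hc
    cases mid <;> simp only [blocks, List.mem_append, List.mem_replicate] at hc <;>
      rcases hc with ⟨-, rfl⟩ | hc <;> first | exact ih _ _ hc | simp

theorem foldl_frameStep_middle (m : ℤ) (s : (ℤ × ℤ) × (ℤ × ℤ)) :
    (List.replicate m.natAbs (⟨1, decide (0 < m)⟩ : Crossing)).foldl frameStep s =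
      (s.1 - m • s.2, s.2) := by
  have aux : ∀ (r : Bool) (k : ℕ) (s : (ℤ × ℤ) × (ℤ × ℤ)),
      (List.replicate k (⟨1, r⟩ : Crossing)).foldl frameStep s =
        (s.1 - (if r then (k : ℤ) else -k) • s.2, s.2) := by
    intro r k
    induction k with
    | zero => intro s; simp
    | succ k ih =>
      intro s
      rw [List.replicate_succ, List.foldl_cons, ih]
      cases r <;> simp [frameStep] <;> ring_nf
  rw [aux]
  congr 3
  simp only [decide_eq_true_eq]
  split_ifs <;> omega

theorem foldl_frameStep_left (m : ℤ) (s : (ℤ × ℤ) × (ℤ × ℤ)) :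
    (List.replicate m.natAbs (⟨0, decide (m < 0)⟩ : Crossing)).foldl frameStep s =
      (s.1, s.2 - m • s.1) := by
  have aux : ∀ (r : Bool) (k : ℕ) (s : (ℤ × ℤ) × (ℤ × ℤ)),
      (List.replicate k (⟨0, r⟩ : Crossing)).foldl frameStep s =
        (s.1, s.2 - (if r then -(k : ℤ) else k) • s.1) := by
    intro r k
    induction k with
    | zero => intro s; simp
    | succ k ih =>
      intro s
      rw [List.replicate_succ, List.foldl_cons, ih]
      cases r <;> simp [frameStep] <;> ring_nf
  rw [aux]
  congr 3
  simp only [decide_eq_true_eq]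
  split_ifs <;> omega

/-- The line whose meridian is closed up with the last strand. -/
def closingLine (mid : Bool) (s : (ℤ × ℤ) × (ℤ × ℤ)) : ℤ × ℤ := if mid then s.2 else s.1

/-- A block with parameter m subtracts m times one frame vector from the other, after which the two
exchange roles. This is the recursion of `slope`, with one change of sign per block. -/
theorem closingLine_foldl (n : List ℤ) : ∀ (mid : Bool) (s : (ℤ × ℤ) × (ℤ × ℤ)),
    ∃ σ : ℤˣ, closingLine (mid ^^ decide (Odd n.length)) ((blocks mid n).foldl frameStep s) =
      (σ : ℤ) • ((slope n).2 • closingLine mid s - (slope n).1 • closingLine (!mid) s) := by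
  induction n with
  | nil => intro mid s; exact ⟨1, by cases mid <;> simp [blocks, closingLine, slope]⟩
  | cons m n ih =>
    intro mid s
    have hb : (blocks mid (m :: n)).foldl frameStep s = (blocks (!mid) n).foldl frameStep
        (if mid then (s.1 - m • s.2, s.2) else (s.1, s.2 - m • s.1)) := by
      cases mid
      · simp only [blocks, List.foldl_append, foldl_frameStep_left]; rfl
      · simp only [blocks, List.foldl_append, foldl_frameStep_middle]; rfl
    have hp : (mid ^^ decide (Odd (m :: n).length)) = ((!mid) ^^ decide (Odd n.length)) := by
      by_cases h : Odd n.length <;> cases mid <;> simp [h, Nat.odd_add_one]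
    obtain ⟨σ, hσ⟩ := ih (!mid) (if mid then (s.1 - m • s.2, s.2) else (s.1, s.2 - m • s.1))
    refine ⟨-σ, ?_⟩
    rw [hp, hb, hσ]
    cases mid <;> ext <;> simp [closingLine, slope] <;> ring

theorem closingLine_crossings (n : List ℤ) : ∃ σ : ℤˣ,
    closingLine (!decide (Odd n.length)) ((crossings n).foldl frameStep ((0, 1), (1, 0))) =
      ((σ * (slope n).2 : ℤ), (-σ * (slope n).1 : ℤ)) := by
  obtain ⟨σ, h⟩ := closingLine_foldl n true ((0, 1), (1, 0))
  refine ⟨σ, ?_⟩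
  rw [Bool.true_xor] at h
  rw [crossings, h]
  ext <;> simp [closingLine]

theorem frameInvariant_level {G : Type*} [Group G] {A B : G} {n : List ℤ}
    {x : Fin ((crossings n).length + 1) → Fin 4 → G} (h1 : x 0 0 = A) (h2 : x 0 1 = A⁻¹)
    (h3 : x 0 2 = B⁻¹) (h4 : x 0 3 = B)
    (hx : ∀ t : Fin (crossings n).length, x t.succ = hurwitzStep (crossing n t) (x t.castSucc))
    (t : Fin ((crossings n).length + 1)) :
    FrameInvariant A B (((crossings n).take t).foldl frameStep ((0, 1), (1, 0))) (x t) := by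
  induction t using Fin.induction with
  | zero => simpa using frameInvariant_start h1 h2 h3 h4
  | succ t ih =>
    rw [hx, Fin.val_succ, List.take_succ_eq_append_getElem t.2, List.foldl_append]
    exact ih.step (crossings_pos_ne_two n true _ (List.getElem_mem _))

/-- The downward meridian of the strand that is closed up with the last strand. -/
theorem closing_meridian {G : Type*} [Group G] {A B : G} {n : List ℤ}
    {x : Fin ((crossings n).length + 1) → Fin 4 → G} (h1 : x 0 0 = A) (h2 : x 0 1 = A⁻¹)
    (h3 : x 0 2 = B⁻¹) (h4 : x 0 3 = B)
    (hx : ∀ t : Fin (crossings n).length, x t.succ = hurwitzStep (crossing n t) (x t.castSucc)) :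
    ∃ (σ : ℤˣ) (j : ℤ), x (Fin.last _) (if Odd n.length then 2 else 0) =
      twist B j (arcMeridian A B (slope n).2.natAbs (σ * (slope n).1)) := by
  have h := frameInvariant_level h1 h2 h3 h4 hx (Fin.last _)
  rw [Fin.val_last, List.take_length] at h
  obtain ⟨σ, hσ⟩ := closingLine_crossings n
  have hj : ∃ j, x (Fin.last _) (if Odd n.length then 2 else 0) = twist B j (lineMeridian A B
      (closingLine (!decide (Odd n.length))
        ((crossings n).foldl frameStep ((0, 1), (1, 0))))) := by
    obtain ⟨j, h0, h2⟩ := h.lines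
    by_cases hn : Odd n.length
    · exact ⟨_, by simpa [hn, closingLine] using h2⟩
    · exact ⟨_, by simpa [hn, closingLine] using h0⟩
  obtain ⟨j, hj⟩ := hj
  rw [hσ] at hj
  have habs : (σ * (slope n).2 : ℤ).natAbs = (slope n).2.natAbs := by
    rw [Int.natAbs_mul, Int.units_natAbs, one_mul]
  generalize (if Odd n.length then (2 : Fin 4) else 0) = p at hj ⊢
  simp only [lineMeridian, habs] at hj
  split_ifs at hj
  · exact ⟨-σ, j, by simpa using hj⟩
  · exact ⟨σ, j, by simpa using hj⟩

/-! ### Parabolic matrices attached to vectors -/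

section Parabolic

variable {R : Type*} [CommRing R]

/-- The determinant of the pair of column vectors `x`, `y`. -/
def sympl (x y : Fin 2 → R) : R := x 0 * y 1 - x 1 * y 0

/-- The inverse of the transvection `v ↦ v + ⟨v, x⟩ x`. -/
def parabolic (x : Fin 2 → R) : Matrix.SpecialLinearGroup (Fin 2) R :=
  ⟨!![1 - x 0 * x 1, x 0 ^ 2; -x 1 ^ 2, 1 + x 0 * x 1], by rw [Matrix.det_fin_two_of]; ring⟩

theorem parabolic_coe (x : Fin 2 → R) : (parabolic x : Matrix (Fin 2) (Fin 2) R) =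
    !![1 - x 0 * x 1, x 0 ^ 2; -x 1 ^ 2, 1 + x 0 * x 1] := rfl

theorem parabolic_inv_coe (x : Fin 2 → R) : ((parabolic x)⁻¹ : Matrix.SpecialLinearGroup _ R) =
    (!![1 + x 0 * x 1, -x 0 ^ 2; x 1 ^ 2, 1 - x 0 * x 1] : Matrix (Fin 2) (Fin 2) R) := by
  rw [Matrix.SpecialLinearGroup.coe_inv, parabolic_coe, Matrix.adjugate_fin_two_of, neg_neg]

theorem parabolic_neg (x : Fin 2 → R) : parabolic (-x) = parabolic x := by
  apply Subtype.ext
  simp [parabolic_coe]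

theorem trace_parabolic (x : Fin 2 → R) :
    (parabolic x : Matrix (Fin 2) (Fin 2) R).trace = 2 := by
  rw [parabolic_coe, Matrix.trace_fin_two_of]; ring

/-- Determinant 1 means that g preserves the symplectic form, so it transports transvections. -/
theorem conj_parabolic (g : Matrix.SpecialLinearGroup (Fin 2) R) (x : Fin 2 → R) :
    g * parabolic x * g⁻¹ = parabolic ((g : Matrix (Fin 2) (Fin 2) R).mulVec x) := by
  rw [mul_inv_eq_iff_eq_mul]
  apply Subtype.ext
  have hd : (g : Matrix (Fin 2) (Fin 2) R) 0 0 * (g : Matrix (Fin 2) (Fin 2) R) 1 1 -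
      (g : Matrix (Fin 2) (Fin 2) R) 0 1 * (g : Matrix (Fin 2) (Fin 2) R) 1 0 = 1 := by
    rw [← Matrix.det_fin_two]; exact g.2
  rw [Matrix.SpecialLinearGroup.coe_mul, Matrix.SpecialLinearGroup.coe_mul, parabolic_coe,
    parabolic_coe]
  generalize (g : Matrix (Fin 2) (Fin 2) R) = m at hd ⊢
  ext i j
  fin_cases i <;> fin_cases j <;>
    simp [Matrix.mul_apply, Fin.sum_univ_two, Matrix.mulVec, dotProduct]
  · linear_combination (m 0 0 * x 0 + m 0 1 * x 1) * x 1 * hd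
  · linear_combination (-(m 0 0 * x 0 + m 0 1 * x 1) * x 0) * hd
  · linear_combination (m 1 0 * x 0 + m 1 1 * x 1) * x 1 * hd
  · linear_combination (-(m 1 0 * x 0 + m 1 1 * x 1) * x 0) * hd

/-- The vector on the left is, up to a sign that `parabolic` ignores, the image of x under
`parabolic y ^ (-δ)`. -/
theorem parabolic_quandle (x y : Fin 2 → R) (δ : ℤˣ) :
    parabolic (-(x + (((δ : ℤ) : R) * sympl x y) • y)) =
      parabolic y ^ (-(δ : ℤ)) * parabolic x * parabolic y ^ (δ : ℤ) := by
  have h : parabolic y ^ (δ : ℤ) = (parabolic y ^ (-(δ : ℤ)))⁻¹ := by rw [zpow_neg, inv_inv]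
  rw [parabolic_neg, h, conj_parabolic]
  congr 1
  rcases Int.units_eq_one_or δ with rfl | rfl
  · rw [Units.val_one, zpow_neg, zpow_one, parabolic_inv_coe]
    ext i
    fin_cases i <;> simp [Matrix.mulVec, dotProduct, sympl] <;> ring
  · rw [Units.val_neg, Units.val_one, neg_neg, zpow_one, parabolic_coe]
    ext i
    fin_cases i <;> simp [Matrix.mulVec, dotProduct, sympl] <;> ring

/-- If the quotient of two parabolic elements is lower unitriangular, then it is trivial, or both
elements are lower triangular. -/
theorem parabolic_eq_of_quotient [IsDomain R] (x y : Fin 2 → R) (δ : ℤˣ) (c : R)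
    (h : ((parabolic x ^ (δ : ℤ) * (parabolic y ^ (δ : ℤ))⁻¹ :
      Matrix.SpecialLinearGroup (Fin 2) R) : Matrix (Fin 2) (Fin 2) R) = !![1, 0; c, 1]) :
    (x 0 = 0 ∧ y 0 = 0) ∨ parabolic x = parabolic y := by
  -- The trace of the quotient differs from 2 by ⟨x, y⟩² up to sign, so the bracket vanishes; the
  -- upper right entry then compares the squares.
  have key : sympl x y = 0 ∧ x 0 ^ 2 = y 0 ^ 2 := by
    rcases Int.units_eq_one_or δ with rfl | rfl
    · rw [Units.val_one, zpow_one, zpow_one, Matrix.SpecialLinearGroup.coe_mul, parabolic_inv_coe,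
        parabolic_coe, Matrix.mul_fin_two] at h
      have h00 := congr_fun (congr_fun h 0) 0
      have h01 := congr_fun (congr_fun h 0) 1
      have h11 := congr_fun (congr_fun h 1) 1
      simp at h00 h01 h11
      have hs : sympl x y = 0 := by
        apply pow_eq_zero_iff two_ne_zero |>.1
        unfold sympl
        linear_combination h00 + h11
      refine ⟨hs, ?_⟩
      unfold sympl at hs
      linear_combination h01 + x 0 * y 0 * hs
    · rw [Units.val_neg, Units.val_one, zpow_neg, zpow_neg, inv_inv, zpow_one, zpow_one,
        Matrix.SpecialLinearGroup.coe_mul, parabolic_inv_coe, parabolic_coe,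
        Matrix.mul_fin_two] at h
      have h00 := congr_fun (congr_fun h 0) 0
      have h01 := congr_fun (congr_fun h 0) 1
      have h11 := congr_fun (congr_fun h 1) 1
      simp at h00 h01 h11
      have hs : sympl x y = 0 := by
        apply pow_eq_zero_iff two_ne_zero |>.1
        unfold sympl
        linear_combination h00 + h11
      refine ⟨hs, ?_⟩
      unfold sympl at hs
      linear_combination -h01 - x 0 * y 0 * hs
  obtain ⟨hs, h0⟩ := key
  unfold sympl at hs
  by_cases hx : x 0 = 0
  · left
    refine ⟨hx, ?_⟩
    rw [hx] at h0
    exact pow_eq_zero_iff two_ne_zero |>.1 (by simpa using h0.symm)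
  · right
    rcases sq_eq_sq_iff_eq_or_eq_neg.1 h0 with h | h
    · have h1 : x 1 = y 1 := mul_left_cancel₀ hx (by rw [h] at hs ⊢; linear_combination -hs)
      congr 1
      ext i; fin_cases i <;> assumption
    · have h1 : x 1 = -y 1 := by
        apply mul_left_cancel₀ hx
        have : y 0 = -x 0 := by rw [h, neg_neg]
        rw [this] at hs
        linear_combination hs
      rw [← parabolic_neg y]
      congr 1
      ext i; fin_cases i <;> assumption

end Parabolic

/-! ### Colourings of the diagram and downward meridians -/

section Colorings

variable {n : List ℤ} {o : Orientation n} {H : Type*} [Group H]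

theorem Crossing.pass_pass (c : Crossing) (p : Fin 4) : c.pass (c.pass p) = p :=
  Equiv.swap_apply_self _ _ _

theorem Crossing.pass_three {c : Crossing} (hc : c.pos ≠ 2) :
    c.pass 3 = 3 ∧ 3 ≠ c.pass c.underIn := by
  obtain ⟨pos, r⟩ := c
  fin_cases pos <;> cases r <;> first | exact absurd rfl hc | decide

theorem crossing_pos_ne_two (t : Fin (crossings n).length) : (crossing n t).pos ≠ 2 :=
  crossings_pos_ne_two n true _ (List.getElem_mem _)

variable (o) in
/-- An assignment of group elements to the segments satisfying the relations at the crossings. -/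
structure IsColoring (g : Segment n → H) : Prop where
  same : ∀ (t : Fin (crossings n).length) (p : Fin 4), p ≠ (crossing n t).underIn →
    g (t.succ, (crossing n t).pass p) = g (t.castSucc, p)
  under : ∀ t : Fin (crossings n).length, g (t.succ, (crossing n t).pass (crossing n t).underIn) =
    g (t.castSucc, (crossing n t).overIn) ^ (-(quandleSign o t : ℤ)) *
      g (t.castSucc, (crossing n t).underIn) *
      g (t.castSucc, (crossing n t).overIn) ^ (quandleSign o t : ℤ)

theorem IsColoring.eq_of_top {g g' : Segment n → H} (h : IsColoring o g) (h' : IsColoring o g')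
    (htop : ∀ p, g (0, p) = g' (0, p)) : g = g' := by
  suffices ∀ t p, g (t, p) = g' (t, p) from funext fun s => this s.1 s.2
  intro t
  induction t using Fin.induction with
  | zero => exact htop
  | succ t ih =>
    intro p
    rw [← (crossing n t).pass_pass p]
    by_cases hp : (crossing n t).pass p = (crossing n t).underIn
    · rw [hp, h.under, h'.under, ih, ih]
    · rw [h.same t _ hp, h'.same t _ hp, ih]

/-- The meridians with respect to the downward direction. -/
def downward (o : Orientation n) (g : Segment n → H) (t : Fin ((crossings n).length + 1))
    (p : Fin 4) : H := g (t, p) ^ (o.dir (t, p) : ℤ)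

/-- Measured downward, the crossing rule does not depend on the orientation: the direction of the
over-arc cancels against its occurrence in `quandleSign`. -/
theorem IsColoring.downward_succ {g : Segment n → H} (h : IsColoring o g)
    (t : Fin (crossings n).length) :
    downward o g t.succ = hurwitzStep (crossing n t) (downward o g t.castSucc) := by
  funext p
  unfold hurwitzStep
  obtain ⟨q, rfl⟩ : ∃ q, p = (crossing n t).pass q := ⟨_, ((crossing n t).pass_pass p).symm⟩
  have hiff : (crossing n t).pass q = (crossing n t).pass (crossing n t).underIn ↔
      q = (crossing n t).underIn := (Equiv.swap _ _).injective.eq_iff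
  simp only [hiff, Crossing.pass_pass, downward, o.pass]
  split_ifs with hq hr
  · subst hq
    rw [h.under]
    simp only [quandleSign, hr, if_true]
    rcases Int.units_eq_one_or (o.dir (t.castSucc, (crossing n t).overIn)) with h1 | h1 <;>
    rcases Int.units_eq_one_or (o.dir (t.castSucc, (crossing n t).underIn)) with h2 | h2 <;>
      rw [h1, h2] <;> simp <;> group
  · subst hq
    rw [h.under]
    simp only [quandleSign, hr]
    rcases Int.units_eq_one_or (o.dir (t.castSucc, (crossing n t).overIn)) with h1 | h1 <;>
    rcases Int.units_eq_one_or (o.dir (t.castSucc, (crossing n t).underIn)) with h2 | h2 <;>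
      rw [h1, h2] <;> simp <;> group
  · rw [h.same t q hq]

theorem downward_top {g : Segment n → H} (h01 : g (0, 0) = g (0, 1)) (h23 : g (0, 2) = g (0, 3)) :
    downward o g 0 1 = (downward o g 0 0)⁻¹ ∧ downward o g 0 2 = (downward o g 0 3)⁻¹ := by
  have e1 := o.top 0 1 (by decide)
  have e2 := o.top 2 3 (by decide)
  simp only [downward, e1, e2, h01, h23]
  simp

theorem dir_three (o : Orientation n) (t : Fin ((crossings n).length + 1)) :
    o.dir (t, 3) = o.dir (0, 3) := by
  induction t using Fin.induction with
  | zero => rfl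
  | succ t ih =>
    rw [← ih, ← o.pass, (Crossing.pass_three (crossing_pos_ne_two t)).1]

theorem IsColoring.prod_downward {g : Segment n → H} (h : IsColoring o g)
    (h01 : g (0, 0) = g (0, 1)) (h23 : g (0, 2) = g (0, 3))
    (t : Fin ((crossings n).length + 1)) :
    downward o g t 0 * downward o g t 1 * downward o g t 2 * downward o g t 3 = 1 := by
  have := frameInvariant_level rfl (downward_top h01 h23).1 (downward_top h01 h23).2 rfl
    h.downward_succ t
  rw [this.last, this.prod]

end Colorings

/-! ### Arc vectors under a specialization of u -/

section ArcVectors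

variable {n : List ℤ} (o : Orientation n) {R : Type*} [CommRing R] (φ : ℤ[X] →+* R)

/-- The image of an arc vector under a specialization of `u`. -/
noncomputable def arcAt (t : Fin ((crossings n).length + 1)) (p : Fin 4) : Fin 2 → R :=
  fun i => φ (arcVec o t p i)

theorem arcVec_succ (t : Fin (crossings n).length) (p : Fin 4) :
    arcVec o t.succ p = if p = (crossing n t).pass (crossing n t).underIn then
        -(arcVec o t.castSucc (crossing n t).underIn + (((quandleSign o t : ℤ) : ℤ[X]) *
          bracket (arcVec o t.castSucc (crossing n t).underIn)
            (arcVec o t.castSucc (crossing n t).overIn)) •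
          arcVec o t.castSucc (crossing n t).overIn)
      else arcVec o t.castSucc ((crossing n t).pass p) := by
  unfold arcVec
  rw [Fin.induction_succ]

theorem arcAt_under (t : Fin (crossings n).length) :
    arcAt o φ t.succ ((crossing n t).pass (crossing n t).underIn) =
      -(arcAt o φ t.castSucc (crossing n t).underIn + (((quandleSign o t : ℤ) : R) *
          sympl (arcAt o φ t.castSucc (crossing n t).underIn)
            (arcAt o φ t.castSucc (crossing n t).overIn)) •
          arcAt o φ t.castSucc (crossing n t).overIn) := by
  ext i
  unfold arcAt
  rw [arcVec_succ, if_pos rfl]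
  simp [bracket, sympl]

theorem arcAt_same (t : Fin (crossings n).length) {p : Fin 4} (hp : p ≠ (crossing n t).underIn) :
    arcAt o φ t.succ ((crossing n t).pass p) = arcAt o φ t.castSucc p := by
  ext i
  unfold arcAt
  rw [arcVec_succ, if_neg, Crossing.pass_pass]
  exact fun h => hp ((Equiv.swap _ _).injective h)

theorem arcAt_top :
    arcAt o φ 0 0 = ![1, 0] ∧ arcAt o φ 0 1 = ![1, 0] ∧
      arcAt o φ 0 2 = ![0, φ X] ∧ arcAt o φ 0 3 = ![0, φ X] := by
  refine ⟨?_, ?_, ?_, ?_⟩ <;> ext i <;> fin_cases i <;> simp [arcAt, arcVec]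

theorem arcAt_three (t : Fin ((crossings n).length + 1)) : arcAt o φ t 3 = ![0, φ X] := by
  induction t using Fin.induction with
  | zero => exact (arcAt_top o φ).2.2.2
  | succ t ih =>
    have h := Crossing.pass_three (crossing_pos_ne_two t)
    rw [← ih]
    have := arcAt_same o φ t (p := 3) (fun h' => h.2 (by rw [← h', h.1]))
    rwa [h.1] at this

theorem isColoring_parabolic : IsColoring o fun s : Segment n => parabolic (arcAt o φ s.1 s.2) where
  same t p hp := by simp only [arcAt_same o φ t hp]
  under t := by simp only [arcAt_under, parabolic_quandle]

/-- The position of the strand closed up with the last strand. -/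
def closingPos (n : List ℤ) : Fin 4 := if Odd n.length then 2 else 0

theorem closingBracket_eq :
    closingBracket o = X * arcVec o (Fin.last _) (closingPos n) 0 := by
  have h : arcVec o (Fin.last _) 3 = ![0, X] := arcAt_three o (RingHom.id _) (Fin.last _)
  unfold closingBracket closingPos
  split_ifs <;> rw [h] <;> simp [bracket, mul_comm]

end ArcVectors

/-! ### The value at u = 0 for a knot -/

section Knot

variable {n : List ℤ} (o : Orientation n)

/-- At u = 0 all vectors stay on the axis of a. Hence all brackets vanish, and a crossing only
changes signs. -/
theorem arcAt_zero_snd (t : Fin ((crossings n).length + 1)) (p : Fin 4) :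
    arcAt o (evalRingHom 0) t p 1 = 0 := by
  induction t using Fin.induction generalizing p with
  | zero =>
    obtain ⟨h0, h1, h2, h3⟩ := arcAt_top o (evalRingHom (0 : ℤ))
    fin_cases p <;> simp [h0, h1, h2, h3]
  | succ t ih =>
    rw [← (crossing n t).pass_pass p]
    by_cases hp : (crossing n t).pass p = (crossing n t).underIn
    · rw [hp, arcAt_under]
      simp [ih]
    · rw [arcAt_same o _ t hp, ih]

/-- At `u = 0` every arc vector is `± a` or zero; this tells the two top arcs apart. -/
noncomputable def topArcIndicator (s : Segment n) : ℤ := arcAt o (evalRingHom 0) s.1 s.2 0 ^ 2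

theorem topArcIndicator_pass (t : Fin (crossings n).length) (p : Fin 4) :
    topArcIndicator o (t.succ, (crossing n t).pass p) = topArcIndicator o (t.castSucc, p) := by
  unfold topArcIndicator
  by_cases hp : p = (crossing n t).underIn
  · subst hp
    simp [arcAt_under, sympl, arcAt_zero_snd]
  · rw [arcAt_same o _ t hp]

theorem topArcIndicator_zero :
    topArcIndicator o (0, 0) = 1 ∧ topArcIndicator o (0, 1) = 1 ∧
      topArcIndicator o (0, 2) = 0 ∧ topArcIndicator o (0, 3) = 0 := by
  obtain ⟨h0, h1, h2, h3⟩ := arcAt_top o (evalRingHom (0 : ℤ))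
  simp [topArcIndicator, h0, h1, h2, h3]

theorem topArcIndicator_eq_zero_or_one (t : Fin ((crossings n).length + 1)) (p : Fin 4) :
    topArcIndicator o (t, p) = 0 ∨ topArcIndicator o (t, p) = 1 := by
  induction t using Fin.induction generalizing p with
  | zero =>
    obtain ⟨h0, h1, h2, h3⟩ := topArcIndicator_zero o
    fin_cases p <;> simp [h0, h1, h2, h3]
  | succ t ih =>
    rw [← (crossing n t).pass_pass p, topArcIndicator_pass]
    exact ih _

theorem sum_topArcIndicator (t : Fin ((crossings n).length + 1)) :
    ∑ p, topArcIndicator o (t, p) = 2 := by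
  induction t using Fin.induction with
  | zero =>
    obtain ⟨h0, h1, h2, h3⟩ := topArcIndicator_zero o
    rw [Fin.sum_univ_four, h0, h1, h2, h3]; rfl
  | succ t ih =>
    rw [← ih, ← Equiv.sum_comp (Equiv.swap (crossing n t).pos.castSucc (crossing n t).pos.succ)]
    exact Finset.sum_congr rfl fun p _ => topArcIndicator_pass o t p

theorem eval_zero_closing_ne_zero (hK : IsKnot n) :
    (arcVec o (Fin.last _) (closingPos n) 0).eval 0 ≠ 0 := by
  intro h
  have hz : topArcIndicator o (Fin.last _, closingPos n) = 0 := by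
    simp only [topArcIndicator, arcAt, coe_evalRingHom, h]
    norm_num
  have h3 : topArcIndicator o (Fin.last _, 3) = 0 := by
    simp [topArcIndicator, arcAt_three]
  have hsum := sum_topArcIndicator o (Fin.last _)
  rw [Fin.sum_univ_four] at hsum
  have hv := topArcIndicator_eq_zero_or_one o (Fin.last _)
  have hj : ∀ s s', Joined n s s' → topArcIndicator o s = topArcIndicator o s' := by
    intro s s' hs
    obtain ⟨t, p⟩ | ⟨p, q, hpq⟩ | ⟨p, q, hpq⟩ := hs
    · exact (topArcIndicator_pass o t p).symm
    · obtain ⟨h0, h1, h2, h3⟩ := topArcIndicator_zero o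
      simp only [topCaps, List.mem_cons, Prod.mk.injEq, List.not_mem_nil, or_false] at hpq
      rcases hpq with ⟨rfl, rfl⟩ | ⟨rfl, rfl⟩
      · rw [h0, h1]
      · rw [h2, h3]
    · have hv0 := hv 0
      have hv1 := hv 1
      have hv2 := hv 2
      unfold bottomCaps at hpq
      unfold closingPos at hz
      -- The four indicators are 0 or 1 with sum 2. The closing and the last strand have 0, so the
      -- other two have 1, and both caps join equal values.
      split_ifs at hpq hz <;>
        simp only [List.mem_cons, Prod.mk.injEq, List.not_mem_nil, or_false] at hpq <;>
        rcases hpq with ⟨rfl, rfl⟩ | ⟨rfl, rfl⟩ <;> omega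
  have heq : ∀ s s', Relation.EqvGen (Joined n) s s' →
      topArcIndicator o s = topArcIndicator o s' := by
    intro s s' hs
    induction hs with
    | rel _ _ h => exact hj _ _ h
    | refl => rfl
    | symm _ _ _ ih => exact ih.symm
    | trans _ _ _ _ _ ih1 ih2 => exact ih1.trans ih2
  have := heq _ _ (hK (0, 0) (0, 3))
  rw [(topArcIndicator_zero o).1, (topArcIndicator_zero o).2.2.2] at this
  exact one_ne_zero this

end Knot

/-! ### Closing up at the bottom -/

section Closing

variable {n : List ℤ} (o : Orientation n) {R : Type*} [CommRing R] (φ : ℤ[X] →+* R)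

/-- Vanishing of all first coordinates propagates upward through the crossings and would contradict
a = (1, 0) at the top. -/
theorem exists_arcAt_fst_ne_zero [Nontrivial R] (t : Fin ((crossings n).length + 1)) :
    ∃ p, arcAt o φ t p 0 ≠ 0 := by
  by_contra! h
  have : ∀ p, arcAt o φ 0 p 0 = 0 := by
    induction t using Fin.induction with
    | zero => exact h
    | succ t ih =>
      apply ih
      have same : ∀ p, p ≠ (crossing n t).underIn → arcAt o φ t.castSucc p 0 = 0 := by
        intro p hp
        rw [← arcAt_same o φ t hp, h]
      intro p
      by_cases hp : p = (crossing n t).underIn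
      · have hover : (crossing n t).overIn ≠ (crossing n t).underIn := by
          obtain ⟨pos, r⟩ := crossing n t
          fin_cases pos <;> cases r <;> decide
        have hnew := h ((crossing n t).pass (crossing n t).underIn)
        rw [arcAt_under] at hnew
        simpa [same _ hover, hp] using hnew
      · exact same p hp
  have h0 := this 0
  rw [(arcAt_top o φ).1] at h0
  simp at h0

theorem parabolic_lower (x : Fin 2 → R) (hx : x 0 = 0) (δ : ℤ) :
    ∃ c, ((parabolic x ^ δ : Matrix.SpecialLinearGroup (Fin 2) R) : Matrix (Fin 2) (Fin 2) R) =
      !![1, 0; c, 1] := by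
  have hn : ∀ k : ℕ, ((parabolic x ^ k : Matrix.SpecialLinearGroup (Fin 2) R) :
      Matrix (Fin 2) (Fin 2) R) = !![1, 0; -k * x 1 ^ 2, 1] := by
    intro k
    induction k with
    | zero => simp [Matrix.one_fin_two]
    | succ k ih =>
      rw [pow_succ, Matrix.SpecialLinearGroup.coe_mul, ih, parabolic_coe, hx]
      simp
      ring
  obtain ⟨k, rfl | rfl⟩ := Int.eq_nat_or_neg δ
  · exact ⟨_, by rw [zpow_natCast, hn]⟩
  · refine ⟨k * x 1 ^ 2, ?_⟩
    rw [zpow_neg, zpow_natCast, Matrix.SpecialLinearGroup.coe_inv, hn, Matrix.adjugate_fin_two_of]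
    simp

theorem lower_mul_lower {g h : Matrix.SpecialLinearGroup (Fin 2) R}
    (hg : ∃ c, (g : Matrix (Fin 2) (Fin 2) R) = !![1, 0; c, 1])
    (hh : ∃ c, (h : Matrix (Fin 2) (Fin 2) R) = !![1, 0; c, 1]) :
    ∃ c, ((g * h : Matrix.SpecialLinearGroup (Fin 2) R) : Matrix (Fin 2) (Fin 2) R) =
      !![1, 0; c, 1] := by
  obtain ⟨c, hc⟩ := hg
  obtain ⟨d, hd⟩ := hh
  exact ⟨c + d, by rw [Matrix.SpecialLinearGroup.coe_mul, hc, hd]; simp⟩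

theorem lower_inv {g : Matrix.SpecialLinearGroup (Fin 2) R}
    (hg : ∃ c, (g : Matrix (Fin 2) (Fin 2) R) = !![1, 0; c, 1]) :
    ∃ c, ((g⁻¹ : Matrix.SpecialLinearGroup (Fin 2) R) : Matrix (Fin 2) (Fin 2) R) =
      !![1, 0; c, 1] := by
  obtain ⟨c, hc⟩ := hg
  exact ⟨-c, by rw [Matrix.SpecialLinearGroup.coe_inv, hc, Matrix.adjugate_fin_two_of]; simp⟩

/-- A zero of the closing bracket makes all bottom caps close up. -/
theorem parabolic_bottom [IsDomain R] (h : arcAt o φ (Fin.last _) (closingPos n) 0 = 0) (p q : Fin 4)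
    (hpq : (p, q) ∈ bottomCaps n) :
    parabolic (arcAt o φ (Fin.last _) p) = parabolic (arcAt o φ (Fin.last _) q) := by
  have hcol := isColoring_parabolic o φ
  obtain ⟨ht0, ht1, ht2, ht3⟩ := arcAt_top o φ
  have hprod := hcol.prod_downward (by simp only [ht0, ht1]) (by simp only [ht2, ht3]) (Fin.last _)
  have h3 : arcAt o φ (Fin.last _) 3 0 = 0 := by rw [arcAt_three]; rfl
  obtain ⟨r, hr⟩ := exists_arcAt_fst_ne_zero o φ (Fin.last _)
  have hinj : ∀ (δ : ℤˣ) (x y : Matrix.SpecialLinearGroup (Fin 2) R),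
      x ^ (δ : ℤ) * (y ^ (δ : ℤ))⁻¹ = 1 → x = y := by
    intro δ x y hxy
    rw [mul_inv_eq_one] at hxy
    rcases Int.units_eq_one_or δ with rfl | rfl <;> simpa using hxy
  have hdir := o.bottom
  unfold bottomCaps at hdir hpq
  unfold closingPos at h
  have hlow := fun p hp => parabolic_lower (arcAt o φ (Fin.last _) p) hp (o.dir (Fin.last _, p))
  simp only [downward] at hprod
  split_ifs at h hdir hpq
  · have d1 := hdir 0 1 (by decide)
    have d3 := hdir 2 3 (by decide)
    have l2 := hlow 2 h
    have l3 := hlow 3 h3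
    rw [d3] at l3 hprod
    rw [d1] at hprod
    simp only [Units.val_neg, zpow_neg] at hprod l3
    have hq := lower_inv (lower_mul_lower l2 l3)
    rw [mul_assoc, mul_eq_one_iff_eq_inv] at hprod
    rw [← hprod] at hq
    obtain ⟨c, hc⟩ := hq
    -- Strands 2 and 3 are lower unitriangular, hence by the product relation so is the quotient of
    -- the other two. If those were lower triangular as well, all four first coordinates would
    -- vanish. Once this cap closes, the product relation closes the other.
    have key : parabolic (arcAt o φ (Fin.last _) 0) = parabolic (arcAt o φ (Fin.last _) 1) := by
      refine (parabolic_eq_of_quotient _ _ _ c hc).resolve_left ?_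
      rintro ⟨h0, h1⟩
      fin_cases r <;> exact hr (by assumption)
    rw [key, mul_inv_cancel, eq_comm, inv_eq_one] at hprod
    simp only [List.mem_cons, Prod.mk.injEq, List.not_mem_nil, or_false] at hpq
    rcases hpq with ⟨rfl, rfl⟩ | ⟨rfl, rfl⟩
    · exact key
    · exact hinj _ _ _ hprod
  · have d2 := hdir 1 2 (by decide)
    have d3 := hdir 0 3 (by decide)
    have l0 := hlow 0 h
    have l3 := hlow 3 h3
    rw [d3] at l3 hprod
    rw [d2] at hprod
    simp only [Units.val_neg, zpow_neg] at hprod l3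
    rw [mul_eq_one_iff_eq_inv, inv_inv, mul_assoc, ← eq_inv_mul_iff_mul_eq] at hprod
    have hq := lower_mul_lower (lower_inv l0) (lower_inv l3)
    rw [inv_inv, ← hprod] at hq
    obtain ⟨c, hc⟩ := hq
    have key : parabolic (arcAt o φ (Fin.last _) 1) = parabolic (arcAt o φ (Fin.last _) 2) := by
      refine (parabolic_eq_of_quotient _ _ _ c hc).resolve_left ?_
      rintro ⟨h0, h1⟩
      fin_cases r <;> exact hr (by assumption)
    rw [key, mul_inv_cancel, eq_comm, inv_mul_eq_one] at hprod
    simp only [List.mem_cons, Prod.mk.injEq, List.not_mem_nil, or_false] at hpq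
    rcases hpq with ⟨rfl, rfl⟩ | ⟨rfl, rfl⟩
    · exact key
    · exact hinj _ _ _ (by rw [hprod, mul_inv_cancel])

end Closing

/-! ### Homomorphisms from the link group -/

section Representations

variable {n : List ℤ} {o : Orientation n} {H : Type*} [Group H]

theorem isColoring_meridian : IsColoring o (meridian o) where
  same t p hp := by
    have := PresentedGroup.one_of_mem (rels := {r | WirtingerRelator n o r})
      (WirtingerRelator.same t p hp)
    rw [map_mul, map_inv, mul_inv_eq_one] at this
    exact this
  under t := by
    have := PresentedGroup.one_of_mem (rels := {r | WirtingerRelator n o r})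
      (WirtingerRelator.under t)
    rw [map_mul, map_inv, mul_inv_eq_one, map_mul, map_mul, map_zpow, map_zpow] at this
    exact this

theorem meridian_top (p q : Fin 4) (h : (p, q) ∈ topCaps) :
    meridian o (0, p) = meridian o (0, q) := by
  have := PresentedGroup.one_of_mem (rels := {r | WirtingerRelator n o r})
    (WirtingerRelator.top p q h)
  rw [map_mul, map_inv, mul_inv_eq_one] at this
  exact this

theorem meridian_bottom (p q : Fin 4) (h : (p, q) ∈ bottomCaps n) :
    meridian o (Fin.last _, p) = meridian o (Fin.last _, q) := by
  have := PresentedGroup.one_of_mem (rels := {r | WirtingerRelator n o r})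
    (WirtingerRelator.bottom p q h)
  rw [map_mul, map_inv, mul_inv_eq_one] at this
  exact this

theorem IsColoring.map {g : Segment n → H} (h : IsColoring o g) {K : Type*} [Group K]
    (f : H →* K) : IsColoring o fun s => f (g s) where
  same t p hp := by rw [h.same t p hp]
  under t := by rw [h.under, map_mul, map_mul, map_zpow, map_zpow]

/-- The homomorphism given by a coloring that closes up at the caps. -/
def IsColoring.lift {g : Segment n → H} (h : IsColoring o g)
    (htop : ∀ p q, (p, q) ∈ topCaps → g (0, p) = g (0, q))
    (hbot : ∀ p q, (p, q) ∈ bottomCaps n → g (Fin.last _, p) = g (Fin.last _, q)) :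
    LinkGroup n o →* H :=
  PresentedGroup.toGroup (f := g) (by
    rintro r (⟨p, q, hpq⟩ | ⟨p, q, hpq⟩ | ⟨t, p, hp⟩ | ⟨t⟩)
    · simp [htop p q hpq]
    · simp [hbot p q hpq]
    · simp [h.same t p hp]
    · simp only [map_mul, map_inv, map_zpow, FreeGroup.lift_apply_of]
      rw [h.under, mul_inv_cancel])

theorem IsColoring.lift_meridian {g : Segment n → H} (h : IsColoring o g)
    (htop : ∀ p q, (p, q) ∈ topCaps → g (0, p) = g (0, q))
    (hbot : ∀ p q, (p, q) ∈ bottomCaps n → g (Fin.last _, p) = g (Fin.last _, q))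
    (s : Segment n) : h.lift htop hbot (meridian o s) = g s :=
  PresentedGroup.toGroup.of _

theorem linkGroup_hom_ext {f f' : LinkGroup n o →* H}
    (h : ∀ s, f (meridian o s) = f' (meridian o s)) : f = f' :=
  PresentedGroup.ext h

/-- Homomorphisms are determined by the values at the two top arcs. -/
theorem linkGroup_hom_ext_top {f f' : LinkGroup n o →* H}
    (h0 : f (meridian o (0, 0)) = f' (meridian o (0, 0)))
    (h3 : f (meridian o (0, 3)) = f' (meridian o (0, 3))) : f = f' := by
  refine linkGroup_hom_ext fun s => congr_fun (IsColoring.eq_of_top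
    (isColoring_meridian.map f) (isColoring_meridian.map f') fun p => ?_) s
  have h01 := meridian_top (o := o) 0 1 (by decide)
  have h23 := meridian_top (o := o) 2 3 (by decide)
  fin_cases p
  · exact h0
  · simpa [← h01] using h0
  · simpa [h23] using h3
  · exact h3

/-- If the two top meridians have commuting images, the conjugations at the crossings do nothing, so
every meridian has one of these two images. -/
theorem commute_of_commute_top {f : LinkGroup n o →* H}
    (h : Commute (f (meridian o (0, 0))) (f (meridian o (0, 3)))) (x y : LinkGroup n o) :
    f x * f y = f y * f x := by
  have hrange : ∀ t p, f (meridian o (t, p)) = f (meridian o (0, 0)) ∨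
      f (meridian o (t, p)) = f (meridian o (0, 3)) := by
    intro t
    induction t using Fin.induction with
    | zero =>
      have h01 := meridian_top (o := o) 0 1 (by decide)
      have h23 := meridian_top (o := o) 2 3 (by decide)
      intro p
      fin_cases p
      · exact Or.inl rfl
      · exact Or.inl (congrArg f h01.symm)
      · exact Or.inr (congrArg f h23)
      · exact Or.inr rfl
    | succ t ih =>
      have hc : ∀ p q, Commute (f (meridian o (t.castSucc, p))) (f (meridian o (t.castSucc, q))) := by
        intro p q
        rcases ih p with hp | hp <;> rcases ih q with hq | hq <;> rw [hp, hq]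
        · exact h
        · exact h.symm
      intro p
      rw [← (crossing n t).pass_pass p]
      by_cases hp : (crossing n t).pass p = (crossing n t).underIn
      · rw [hp, (isColoring_meridian.map f).under,
          ((hc (crossing n t).overIn (crossing n t).underIn).zpow_left _).eq, mul_assoc,
          ← zpow_add, neg_add_cancel, zpow_zero, mul_one]
        exact ih _
      · rw [(isColoring_meridian.map f).same t _ hp]
        exact ih _
  have hgen : ∀ s s', Commute (f (meridian o s)) (f (meridian o s')) := by
    rintro ⟨t, p⟩ ⟨t', p'⟩
    rcases hrange t p with hp | hp <;> rcases hrange t' p' with hq | hq <;> rw [hp, hq]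
    · exact h
    · exact h.symm
  have htop := PresentedGroup.closure_range_of {r | WirtingerRelator n o r}
  have h1 : ∀ s (y : LinkGroup n o), Commute (f (meridian o s)) (f y) := by
    intro s y
    have hy : y ∈ Subgroup.closure
        (Set.range (PresentedGroup.of (rels := {r | WirtingerRelator n o r}))) := by
      rw [htop]; trivial
    induction hy using Subgroup.closure_induction with
    | mem y hy => obtain ⟨s', rfl⟩ := hy; exact hgen s s'
    | one => simp
    | mul y z _ _ hy hz => rw [map_mul]; exact hy.mul_right hz
    | inv y _ hy => rw [map_inv]; exact hy.inv_right
  have hx : x ∈ Subgroup.closure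
      (Set.range (PresentedGroup.of (rels := {r | WirtingerRelator n o r}))) := by
    rw [htop]; trivial
  change Commute (f x) (f y)
  induction hx using Subgroup.closure_induction with
  | mem x hx => obtain ⟨s', rfl⟩ := hx; exact h1 s' y
  | one => simp
  | mul x z _ _ hx hz => rw [map_mul]; exact hx.mul_left hz
  | inv x _ hx => rw [map_inv]; exact hx.inv_left

end Representations

/-! ### Roots and conjugacy classes of parabolic representations -/

section Complex

/-- Matrices of trace `2` in `SL(2, ℂ)` are parabolic elements. -/
theorem exists_eq_parabolic (g : SL2C) (h : (g : Matrix (Fin 2) (Fin 2) ℂ).trace = 2) :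
    ∃ x, g = parabolic x := by
  obtain ⟨a, ha⟩ := IsAlgClosed.exists_pow_nat_eq ((g : Matrix (Fin 2) (Fin 2) ℂ) 0 1) two_pos
  obtain ⟨b, hb⟩ := IsAlgClosed.exists_pow_nat_eq (-(g : Matrix (Fin 2) (Fin 2) ℂ) 1 0) two_pos
  have hd : (g : Matrix (Fin 2) (Fin 2) ℂ) 0 0 * (g : Matrix (Fin 2) (Fin 2) ℂ) 1 1 -
      (g : Matrix (Fin 2) (Fin 2) ℂ) 0 1 * (g : Matrix (Fin 2) (Fin 2) ℂ) 1 0 = 1 := by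
    rw [← Matrix.det_fin_two]; exact g.2
  rw [Matrix.trace_fin_two] at h
  suffices ∃ x : Fin 2 → ℂ, (g : Matrix (Fin 2) (Fin 2) ℂ) = (parabolic x : Matrix (Fin 2) (Fin 2) ℂ) by
    obtain ⟨x, hx⟩ := this
    exact ⟨x, Subtype.ext hx⟩
  generalize (g : Matrix (Fin 2) (Fin 2) ℂ) = m at *
  -- The off-diagonal entries fix the coordinates only up to sign; trace and determinant leave the
  -- two possibilities ±ab for `1 - m 0 0`, and the sign of b is chosen to match.
  have ht : (1 - m 0 0) ^ 2 = (a * b) ^ 2 := by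
    linear_combination m 0 0 * h - hd - b ^ 2 * ha - m 0 1 * hb
  rcases sq_eq_sq_iff_eq_or_eq_neg.1 ht with h1 | h1
  · refine ⟨![a, b], ?_⟩
    rw [parabolic_coe]
    ext i j
    fin_cases i <;> fin_cases j <;> simp
    · linear_combination -h1
    · exact ha.symm
    · linear_combination hb
    · linear_combination h + h1
  · refine ⟨![a, -b], ?_⟩
    rw [parabolic_coe]
    ext i j
    fin_cases i <;> fin_cases j <;> simp
    · linear_combination -h1
    · exact ha.symm
    · linear_combination hb
    · linear_combination h + h1

/-- The conjugating matrix is the inverse of the one with columns x and y/⟨x, y⟩, which has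
determinant 1. -/
theorem parabolic_pair_normal_form {x y : Fin 2 → ℂ} (h : sympl x y ≠ 0) :
    ∃ g : SL2C, g * parabolic x * g⁻¹ = parabolic ![1, 0] ∧
      g * parabolic y * g⁻¹ = parabolic ![0, sympl x y] := by
  have hdet : (!![y 1 / sympl x y, -y 0 / sympl x y; -x 1, x 0] :
      Matrix (Fin 2) (Fin 2) ℂ).det = 1 := by
    rw [Matrix.det_fin_two_of]
    field_simp
    unfold sympl; ring
  obtain ⟨g, hg⟩ : ∃ g : SL2C, (g : Matrix (Fin 2) (Fin 2) ℂ) =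
      !![y 1 / sympl x y, -y 0 / sympl x y; -x 1, x 0] := ⟨⟨_, hdet⟩, rfl⟩
  refine ⟨g, ?_, ?_⟩ <;> rw [conj_parabolic, hg] <;> congr 1 <;> ext i <;> fin_cases i <;>
    simp [Matrix.mulVec, dotProduct]
  · field_simp
    unfold sympl; ring
  · ring
  · ring
  · unfold sympl; ring

theorem commute_parabolic {R : Type*} [CommRing R] {x y : Fin 2 → R} (h : sympl x y = 0) :
    Commute (parabolic x) (parabolic y) := by
  unfold sympl at h
  apply Subtype.ext
  rw [Matrix.SpecialLinearGroup.coe_mul, Matrix.SpecialLinearGroup.coe_mul, parabolic_coe,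
    parabolic_coe]
  ext i j
  fin_cases i <;> fin_cases j <;> simp
  · linear_combination -(x 0 * y 1 + y 0 * x 1) * h
  · linear_combination 2 * x 0 * y 0 * h
  · linear_combination -2 * x 1 * y 1 * h
  · linear_combination (x 1 * y 0 + y 1 * x 0) * h

variable {n : List ℤ} (o : Orientation n)

/-- The polynomial `± P_K / u`. -/
noncomputable def closingPoly : ℤ[X] := arcVec o (Fin.last _) (closingPos n) 0

/-- Evaluation at `r`. -/
noncomputable def evalAt (r : ℂ) : ℤ[X] →+* ℂ := (aeval r : ℤ[X] →ₐ[ℤ] ℂ).toRingHom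

theorem evalAt_X (r : ℂ) : evalAt r X = r := aeval_X r

theorem arcAt_top_eq_of_mem_topCaps {R : Type*} [CommRing R] (φ : ℤ[X] →+* R) (p q : Fin 4)
    (h : (p, q) ∈ topCaps) : arcAt o φ 0 p = arcAt o φ 0 q := by
  obtain ⟨h0, h1, h2, h3⟩ := arcAt_top o φ
  simp only [topCaps, List.mem_cons, Prod.mk.injEq, List.not_mem_nil, or_false] at h
  rcases h with ⟨rfl, rfl⟩ | ⟨rfl, rfl⟩
  · rw [h0, h1]
  · rw [h2, h3]

variable {o} in
/-- The parabolic representation belonging to a root. -/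
noncomputable def rootRep {r : ℂ} (h : aeval r (closingPoly o) = 0) : LinkGroup n o →* SL2C :=
  (isColoring_parabolic o (evalAt r)).lift
    (fun p q hpq => by simp only [arcAt_top_eq_of_mem_topCaps o _ p q hpq])
    (fun p q hpq => parabolic_bottom o _ h p q hpq)

variable {o}

theorem rootRep_meridian {r : ℂ} (h : aeval r (closingPoly o) = 0) (s : Segment n) :
    rootRep h (meridian o s) = parabolic (arcAt o (evalAt r) s.1 s.2) :=
  IsColoring.lift_meridian _ _ _ s

theorem rootRep_meridian_left {r : ℂ} (h : aeval r (closingPoly o) = 0) :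
    rootRep h (meridian o (0, 0)) = parabolic ![1, 0] := by
  rw [rootRep_meridian, (arcAt_top o _).1]

theorem rootRep_meridian_right {r : ℂ} (h : aeval r (closingPoly o) = 0) :
    rootRep h (meridian o (0, 3)) = parabolic ![0, r] := by
  rw [rootRep_meridian, arcAt_three, evalAt_X]

theorem root_ne_zero (hK : IsKnot n) {r : ℂ} (h : aeval r (closingPoly o) = 0) : r ≠ 0 := by
  rintro rfl
  apply eval_zero_closing_ne_zero o hK
  have : aeval (0 : ℂ) (closingPoly o) = ((closingPoly o).eval 0 : ℤ) := by
    rw [← coeff_zero_eq_eval_zero, ← coeff_zero_eq_aeval_zero']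
    rfl
  rw [this] at h
  exact_mod_cast h

theorem parabolic_top_not_commute {r : ℂ} (hr : r ≠ 0) :
    parabolic ![1, 0] * parabolic ![0, r] ≠ parabolic ![0, r] * parabolic ![1, 0] := by
  intro h
  have h00 := congr_fun (congr_fun (congrArg Subtype.val h) 0) 0
  simp [parabolic_coe, hr] at h00

theorem isNonabelianParabolic_rootRep (hK : IsKnot n) {r : ℂ} (h : aeval r (closingPoly o) = 0) :
    IsNonabelianParabolic (rootRep h) := by
  refine ⟨fun s => ?_, meridian o (0, 0), meridian o (0, 3), ?_⟩
  · rw [rootRep_meridian, trace_parabolic]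
  · rw [rootRep_meridian_left, rootRep_meridian_right]
    exact parabolic_top_not_commute (root_ne_zero hK h)

/-- A conjugation invariant that recovers r²; it gives the injectivity of the correspondence. -/
theorem trace_rootRep {r : ℂ} (h : aeval r (closingPoly o) = 0) :
    (rootRep h (meridian o (0, 0) * meridian o (0, 3)) : Matrix (Fin 2) (Fin 2) ℂ).trace =
      2 - r ^ 2 := by
  rw [map_mul, rootRep_meridian_left, rootRep_meridian_right, Matrix.SpecialLinearGroup.coe_mul,
    parabolic_coe, parabolic_coe]
  simp
  ring

theorem rootRep_eq_of_sq_eq {r r' : ℂ} (h : aeval r (closingPoly o) = 0)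
    (h' : aeval r' (closingPoly o) = 0) (hr : r ^ 2 = r' ^ 2) : rootRep h = rootRep h' := by
  apply linkGroup_hom_ext_top
  · rw [rootRep_meridian_left, rootRep_meridian_left]
  · rw [rootRep_meridian_right, rootRep_meridian_right]
    rcases sq_eq_sq_iff_eq_or_eq_neg.1 hr with rfl | rfl
    · rfl
    · rw [← parabolic_neg]
      simp

/-- Every non-abelian parabolic representation is conjugate to the one belonging to a root. -/
theorem exists_conj_rootRep (ρ : NonabelianParabolicRep n o) :
    ∃ (r : ℂ) (h : aeval r (closingPoly o) = 0) (g : SL2C),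
      ∀ x, rootRep h x = g * ρ.1 x * g⁻¹ := by
  obtain ⟨ρ, htr, x₀, y₀, hne⟩ := ρ
  obtain ⟨v, hv⟩ := exists_eq_parabolic _ (htr (0, 0))
  obtain ⟨w, hw⟩ := exists_eq_parabolic _ (htr (0, 3))
  have hr : sympl v w ≠ 0 := fun h0 => hne <| commute_of_commute_top (by
    rw [hv, hw]; exact commute_parabolic h0) x₀ y₀
  obtain ⟨g, hg0, hg3⟩ := parabolic_pair_normal_form hr
  generalize sympl v w = r at *
  have hcol : (fun s => (MulAut.conj g) (ρ (meridian o s))) =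
      fun s : Segment n => parabolic (arcAt o (evalAt r) s.1 s.2) := by
    refine IsColoring.eq_of_top ((isColoring_meridian.map ρ).map (MulAut.conj g).toMonoidHom)
      (isColoring_parabolic o _) fun p => ?_
    obtain ⟨h0, h1, h2, h3⟩ := arcAt_top o (evalAt r)
    rw [evalAt_X] at h2 h3
    have h01 := meridian_top (o := o) 0 1 (by decide)
    have h23 := meridian_top (o := o) 2 3 (by decide)
    fin_cases p
    · simpa [hv, h0] using hg0
    · simpa [← h01, hv, h1] using hg0
    · simpa [h23, hw, h2] using hg3
    · simpa [hw, h3] using hg3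
  have hb : parabolic (arcAt o (evalAt r) (Fin.last _) (closingPos n)) =
      parabolic (arcAt o (evalAt r) (Fin.last _) 3) := by
    have hcap : (closingPos n, (3 : Fin 4)) ∈ bottomCaps n := by
      unfold closingPos bottomCaps
      split_ifs <;> simp
    have e1 := congr_fun hcol (Fin.last _, closingPos n)
    have e2 := congr_fun hcol (Fin.last _, 3)
    simp only at e1 e2
    rw [← e1, ← e2, meridian_bottom _ _ hcap]
  -- The upper right entries of the two matrices are the square of the closing coordinate and 0.
  have hroot : aeval r (closingPoly o) = 0 := by
    have h01 := congr_fun (congr_fun (congrArg Subtype.val hb) 0) 1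
    rw [arcAt_three] at h01
    simp [parabolic_coe] at h01
    exact h01
  refine ⟨r, hroot, g, fun x => ?_⟩
  have : rootRep hroot = (MulAut.conj g).toMonoidHom.comp ρ :=
    linkGroup_hom_ext fun s => by
      rw [rootRep_meridian]
      exact (congr_fun hcol s).symm
  rw [this]
  rfl

/-- The correspondence between squares of roots and conjugacy classes. -/
noncomputable def rootClass (hK : IsKnot n)
    (y : {y : ℂ // ∃ r : ℂ, aeval r (closingPoly o) = 0 ∧ r ^ 2 = y}) :
    NonabelianParabolicClass n o :=
  Quotient.mk _ ⟨rootRep y.2.choose_spec.1, isNonabelianParabolic_rootRep hK _⟩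

theorem rootClass_bijective (hK : IsKnot n) : Function.Bijective (rootClass (o := o) hK) := by
  constructor
  · intro y y' h
    obtain ⟨g, hg⟩ := Quotient.exact h
    have e := hg (meridian o (0, 0) * meridian o (0, 3))
    have ht := congrArg (fun m : SL2C => (m : Matrix (Fin 2) (Fin 2) ℂ).trace) e
    simp only at ht
    rw [trace_rootRep, Matrix.SpecialLinearGroup.coe_mul, Matrix.trace_mul_comm,
      ← Matrix.SpecialLinearGroup.coe_mul, inv_mul_cancel_left, trace_rootRep,
      y.2.choose_spec.2, y'.2.choose_spec.2] at ht
    apply Subtype.ext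
    linear_combination ht
  · intro c
    induction c using Quotient.inductionOn with
    | h ρ =>
      obtain ⟨r, h, g, hg⟩ := exists_conj_rootRep ρ
      refine ⟨⟨r ^ 2, r, h, rfl⟩, Quotient.sound ?_⟩
      refine ⟨g⁻¹, fun x => ?_⟩
      set y : {y : ℂ // ∃ r : ℂ, aeval r (closingPoly o) = 0 ∧ r ^ 2 = y} := ⟨r ^ 2, r, h, rfl⟩
      have e : rootRep y.2.choose_spec.1 = rootRep h := rootRep_eq_of_sq_eq _ _ y.2.choose_spec.2
      simp only [e, hg]
      group

end Complex

theorem isCoprime_slope (n : List ℤ) : IsCoprime (slope n).1 (slope n).2 := by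
  induction n with
  | nil => exact isCoprime_zero_left.2 isUnit_one
  | cons m n ih =>
    obtain ⟨a, b, h⟩ := ih
    exact ⟨b - a * m, a, by simp only [slope]; linear_combination h⟩

theorem zpow_units_cases {H : Type*} [Group H] {x y : H} {δ ε : ℤˣ}
    (h : x ^ (δ : ℤ) = y ^ (ε : ℤ)) : x = y ^ ((δ * ε : ℤˣ) : ℤ) := by
  rcases Int.units_eq_one_or δ with rfl | rfl <;> rcases Int.units_eq_one_or ε with rfl | rfl <;>
    simp at h ⊢ <;> first | exact h | (rw [← h, inv_inv])

/-! ### Comparison with the Riley polynomial -/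

section Riley

/-- Conjugation by the diagonal matrix with entries `1`, `-1`. -/
def flipSign {R : Type*} [CommRing R] :
    Matrix.SpecialLinearGroup (Fin 2) R →* Matrix.SpecialLinearGroup (Fin 2) R where
  toFun g := ⟨!![g.1 0 0, -g.1 0 1; -g.1 1 0, g.1 1 1], by
    rw [Matrix.det_fin_two_of, neg_mul_neg, ← Matrix.det_fin_two]; exact g.2⟩
  map_one' := by
    apply Subtype.ext
    simp [Matrix.one_fin_two]
  map_mul' g h := by
    apply Subtype.ext
    change (!![_, _; _, _] : Matrix (Fin 2) (Fin 2) R) = !![_, _; _, _] * !![_, _; _, _]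
    rw [Matrix.mul_fin_two]
    refine Matrix.ext fun i j => ?_
    fin_cases i <;> fin_cases j <;>
      simp [Matrix.SpecialLinearGroup.coe_mul, Matrix.mul_apply, Fin.sum_univ_two] <;> ring

/-- The diagonal entries are 1 here, so inversion just negates the off-diagonal ones. As `flipSign`
keeps diagonal entries, reversing all exponents does not affect the upper left entry of a word. -/
theorem flipSign_parabolic {R : Type*} [CommRing R] (x : Fin 2 → R) (hx : x 0 * x 1 = 0) :
    flipSign (parabolic x) = (parabolic x)⁻¹ := by
  apply Subtype.ext
  rw [parabolic_inv_coe, hx]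
  change !![_, _; _, _] = _
  simp [parabolic_coe, hx]

/-- The matrices of the meridians of the two top arcs. -/
noncomputable def topMatrix (x : ℤ) : Matrix.SpecialLinearGroup (Fin 2) ℤ[X] :=
  if Odd x then parabolic ![1, 0] else parabolic ![0, X]

theorem flipSign_topMatrix (x : ℤ) : flipSign (topMatrix x) = (topMatrix x)⁻¹ := by
  unfold topMatrix
  split_ifs <;> exact flipSign_parabolic _ (by simp)

theorem map_rileyA : Matrix.SpecialLinearGroup.map (compRingHom (X ^ 2)) rileyA =
    parabolic ![1, 0] := by
  apply Subtype.ext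
  change rileyA.1.map (compRingHom (X ^ 2)) = _
  refine Matrix.ext fun i j => ?_
  fin_cases i <;> fin_cases j <;> simp [rileyA, parabolic_coe]

theorem map_rileyB : Matrix.SpecialLinearGroup.map (compRingHom (X ^ 2)) rileyB =
    parabolic ![0, X] := by
  apply Subtype.ext
  change rileyB.1.map (compRingHom (X ^ 2)) = _
  refine Matrix.ext fun i j => ?_
  fin_cases i <;> fin_cases j <;> simp [rileyB, parabolic_coe]

theorem map_rileyW (α : ℕ) (β : ℤ) :
    Matrix.SpecialLinearGroup.map (compRingHom (X ^ 2)) (rileyW α β) =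
      ((List.range (α - 1)).map fun j => topMatrix (j + 1 : ℕ) ^ rileyEps α β (j + 1)).prod := by
  unfold rileyW
  rw [map_list_prod, List.map_map]
  congr 1
  refine List.map_congr_left fun j _ => ?_
  simp only [Function.comp, map_zpow, topMatrix, Int.odd_coe_nat]
  congr 1
  split_ifs
  · exact map_rileyA
  · exact map_rileyB

/-- The Riley polynomial does not change if all exponents are reversed. -/
theorem rileyPoly_comp (α : ℕ) (β : ℤ) (τ : ℤˣ) :
    (rileyPoly α β).comp (X ^ 2) =
      (((List.range (α - 1)).map fun j =>
        topMatrix (j + 1 : ℕ) ^ ((τ : ℤ) * rileyEps α β (j + 1))).prod).1 0 0 := by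
  have h : (rileyPoly α β).comp (X ^ 2) =
      (Matrix.SpecialLinearGroup.map (compRingHom (X ^ 2)) (rileyW α β)).1 0 0 := by
    rw [Matrix.SpecialLinearGroup.map_apply_coe]
    rfl
  rcases Int.units_eq_one_or τ with rfl | rfl
  · simp only [Units.val_one, one_mul]
    rw [h, map_rileyW]
  · have e : ((List.range (α - 1)).map fun j =>
        topMatrix (j + 1 : ℕ) ^ (((-1 : ℤˣ) : ℤ) * rileyEps α β (j + 1))).prod =
        flipSign (((List.range (α - 1)).map fun j =>
          topMatrix (j + 1 : ℕ) ^ (rileyEps α β (j + 1))).prod) := by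
      rw [map_list_prod, List.map_map]
      congr 1
      refine List.map_congr_left fun j _ => ?_
      simp only [Function.comp, map_zpow, flipSign_topMatrix]
      simp
    rw [e, h, map_rileyW]
    rfl

/-- Comparison of the exponents for the slopes `β'/α` and `β/α`. -/
theorem exists_exponent_sign {α : ℕ} (hα : Odd α) {β β' : ℤ} (hβ : Odd β)
    (hco : IsCoprime (α : ℤ) β') (h : β ≡ β' [ZMOD α] ∨ β ≡ -β' [ZMOD α]) (s : ℤˣ) :
    ∃ τ : ℤˣ, ∀ i : ℕ, 0 < i → i < α →
      -(((if Odd (i : ℤ) then s else (β' + 1).negOnePow * s : ℤˣ) : ℤ) *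
        (((i : ℤ) * β' / α).negOnePow : ℤ)) = (τ : ℤ) * rileyEps α β i := by
  have hα0 : (0 : ℤ) < α := by exact_mod_cast hα.pos
  have hα' : Odd (α : ℤ) := by exact_mod_cast hα
  -- Since k and β' have opposite parities, the distinction between odd and even i is the factor
  -- (-1)^((i+1)k). Up to the constant (-1)^k it is the change of the floors when β' is shifted by
  -- αk.
  have hsign : ∀ (k : ℤ) (i : ℕ), Odd (k + β') →
      (if Odd (i : ℤ) then s else (β' + 1).negOnePow * s : ℤˣ) =
        s * ((i + 1) * k : ℤ).negOnePow := by
    intro k i hk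
    rw [← Int.not_even_iff_odd, Int.even_add] at hk
    split_ifs with hi
    · rw [Int.negOnePow_even _ (hi.add_one.mul_right k), mul_one]
    · rw [← Int.not_even_iff_odd, not_not] at hi
      rw [mul_comm]
      congr 1
      rw [Int.negOnePow_eq_iff, Int.even_sub, Int.even_mul, Int.even_add_one, Int.even_add_one]
      tauto
  rcases h with h | h
  · obtain ⟨k, hk⟩ := h.symm.dvd
    have hkodd : Odd (k + β') := by
      have : Odd (β' + α * k) := by rw [← hk]; simpa using hβ
      rw [← Int.not_even_iff_odd, Int.even_add] at this ⊢
      rw [← Int.not_even_iff_odd] at hα'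
      simp only [Int.even_mul] at this
      tauto
    refine ⟨s * k.negOnePow, fun i hi hiα => ?_⟩
    rw [hsign k i hkodd]
    have hfl : (i : ℤ) * β / α = i * β' / α + i * k := by
      rw [show (i : ℤ) * β = i * β' + (i * k) * α by linear_combination (i : ℤ) * hk,
        Int.add_mul_ediv_right _ _ hα0.ne']
    unfold rileyEps
    rw [hfl, show ((i : ℤ) + 1) * k = i * k + k by ring, Int.negOnePow_add, Int.negOnePow_add]
    push_cast
    ring
  · obtain ⟨k, hk⟩ := h.symm.dvd
    have hkodd : Odd (k + β') := by
      have : Odd (-β' + α * k) := by rw [← hk]; simpa using hβ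
      rw [← Int.not_even_iff_odd, Int.even_add] at this ⊢
      rw [← Int.not_even_iff_odd] at hα'
      simp only [Int.even_mul, even_neg] at this
      tauto
    refine ⟨-(s * k.negOnePow), fun i hi hiα => ?_⟩
    rw [hsign k i hkodd]
    -- The -1 appears because iβ'/α is not an integer for 0 < i < α; it only contributes to the
    -- common sign.
    have hfl : (i : ℤ) * β / α = -(i * β' / α) - 1 + i * k := by
      rw [show (i : ℤ) * β = -(i * β') + (i * k) * α by linear_combination (i : ℤ) * hk,
        Int.add_mul_ediv_right _ _ hα0.ne']
      congr 1
      have h1 := Int.emod_nonneg ((i : ℤ) * β') hα0.ne'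
      have h2 := Int.emod_lt_of_pos ((i : ℤ) * β') hα0
      have h3 := Int.mul_ediv_add_emod ((i : ℤ) * β') α
      have h4 : (i : ℤ) * β' % α ≠ 0 := by
        intro h0
        have := Int.le_of_dvd (by exact_mod_cast hi)
          (hco.dvd_of_dvd_mul_right (Int.dvd_of_emod_eq_zero h0))
        omega
      have h5 := lt_of_le_of_ne h1 h4.symm
      rw [Int.ediv_eq_iff_of_pos hα0]
      constructor <;> nlinarith
    unfold rileyEps
    rw [hfl, show ((i : ℤ) + 1) * k = i * k + k by ring, Int.negOnePow_add, Int.negOnePow_add,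
      Int.negOnePow_sub, Int.negOnePow_neg, Int.negOnePow_one]
    push_cast
    ring

variable {n : List ℤ} (o : Orientation n)

theorem closingPoly_riley (hK : IsKnot n) {α : ℕ} {β : ℤ} (hα : α = (slope n).2.natAbs)
    (hβ : Odd β) (h : β ≡ (slope n).1 [ZMOD α] ∨ β ≡ -(slope n).1 [ZMOD α]) :
    closingPoly o = (rileyPoly α β).comp (X ^ 2) ∨
      closingPoly o = -(rileyPoly α β).comp (X ^ 2) := by
  have hcol := isColoring_parabolic o (RingHom.id ℤ[X])
  obtain ⟨ht0, ht1, ht2, ht3⟩ := arcAt_top o (RingHom.id ℤ[X])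
  rw [RingHom.id_apply] at ht2 ht3
  obtain ⟨htop1, htop2⟩ := downward_top (o := o)
    (g := fun s : Segment n => parabolic (arcAt o (RingHom.id ℤ[X]) s.1 s.2))
    (by simp only [ht0, ht1]) (by simp only [ht2, ht3])
  obtain ⟨σ, j, hz⟩ := closing_meridian rfl htop1 htop2 rfl hcol.downward_succ
  rw [← hα] at hz
  simp only [downward, ht0, ht3] at hz
  have hz0 := eval_zero_closing_ne_zero o hK
  set sa := o.dir (0, 0)
  set sb := o.dir (0, 3)
  set β' := σ * (slope n).1
  set A := parabolic (![1, 0] : Fin 2 → ℤ[X]) ^ (sa : ℤ) with hA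
  set B := parabolic (![0, X] : Fin 2 → ℤ[X]) ^ (sb : ℤ) with hB
  change parabolic (arcVec o (Fin.last _) (closingPos n)) ^
    (o.dir (Fin.last _, closingPos n) : ℤ) = _ at hz
  change (arcVec o (Fin.last _) (closingPos n) 0).eval 0 ≠ 0 at hz0
  set z := arcVec o (Fin.last _) (closingPos n)
  set W := lineWord A B 0 0 α β'
  set w := B ^ j * W with hw
  have hz' : parabolic z ^ (o.dir (Fin.last _, closingPos n) : ℤ) =
      w * latticeMeridian A B α β' * w⁻¹ := by
    rw [hz, hw]
    simp only [twist, arcMeridian]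
    change B ^ j * (W * _ * W⁻¹) * B ^ (-j) = _
    group
  have hconj : ∀ (v : Fin 2 → ℤ[X]) (ε : ℤˣ), latticeMeridian A B α β' = parabolic v ^ (ε : ℤ) →
      parabolic z = parabolic (w.1.mulVec v) ^
        ((o.dir (Fin.last _, closingPos n) * ε : ℤˣ) : ℤ) := by
    intro v ε hv
    apply zpow_units_cases
    rw [hz', hv, ← conj_parabolic, conj_zpow]
  have hentry : ∀ (v : Fin 2 → ℤ[X]) (ε : ℤˣ), parabolic z = parabolic v ^ (ε : ℤ) →
      z 0 ^ 2 = (ε : ℤ) • v 0 ^ 2 := by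
    intro v ε hv
    have := congr_fun (congr_fun (congrArg Subtype.val hv) 0) 1
    rcases Int.units_eq_one_or ε with rfl | rfl
    · simpa [parabolic_coe] using this
    · simpa [parabolic_coe, Matrix.adjugate_fin_two_of] using this
  -- For even α the closing meridian would be conjugate to a power of the matrix of b = (0, u), and
  -- z₀ would vanish at u = 0.
  have hodd : Odd α := by
    by_contra hev
    have hm : latticeMeridian A B α β' = parabolic ![0, X] ^ ((sb * β'.negOnePow : ℤˣ) : ℤ) := by
      unfold latticeMeridian
      rw [if_neg (by exact_mod_cast hev), hB, ← zpow_mul, Units.val_mul]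
    have := congrArg (eval 0) (hentry _ _ (hconj _ _ hm))
    simp [Matrix.mulVec, dotProduct] at this
    exact hz0 this
  have hm : latticeMeridian A B α β' = parabolic ![1, 0] ^ ((sa * β'.negOnePow : ℤˣ) : ℤ) := by
    unfold latticeMeridian
    rw [if_pos (by exact_mod_cast hodd), hA, ← zpow_mul, Units.val_mul]
  have hsq := hentry _ _ (hconj _ _ hm)
  have hv : w.1.mulVec ![1, 0] 0 = w.1 0 0 := by simp [Matrix.mulVec, dotProduct]
  rw [hv] at hsq
  -- Otherwise z₀² would be minus a square, which at u = 0 contradicts z₀(0) ≠ 0.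
  have hsign : o.dir (Fin.last _, closingPos n) * (sa * β'.negOnePow) = 1 := by
    refine (Int.units_eq_one_or _).resolve_right fun h1 => ?_
    rw [h1] at hsq
    have := congrArg (eval 0) hsq
    simp at this
    nlinarith [sq_nonneg (eval 0 (w.1 0 0)), lt_of_le_of_ne (sq_nonneg (eval 0 (z 0)))
      (pow_ne_zero 2 hz0).symm]
  rw [hsign, Units.val_one, one_smul] at hsq
  have hdz : o.dir (Fin.last _, closingPos n) = -sb := by
    have hcap : (closingPos n, (3 : Fin 4)) ∈ bottomCaps n := by
      unfold closingPos bottomCaps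
      split_ifs <;> simp
    rw [← neg_eq_iff_eq_neg, ← o.bottom _ _ hcap, dir_three]
  -- The bottom cap joins the closing strand to the last one, so the directions of the two top arcs
  -- are related by the parity of β'.
  have hsb : sb = (β' + 1).negOnePow * sa := by
    rw [hdz] at hsign
    rw [Int.negOnePow_succ]
    rcases Int.units_eq_one_or sa with h1 | h1 <;> rcases Int.units_eq_one_or sb with h2 | h2 <;>
      rcases Int.units_eq_one_or β'.negOnePow with h3 | h3 <;> rw [h1, h2, h3] at hsign ⊢ <;>
      revert hsign <;> decide
  -- Powers of B are lower unitriangular, so left multiplication by them keeps the first row; the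
  -- unknown twist j disappears.
  have hw0 : w.1 0 0 = W.1 0 0 := by
    obtain ⟨c, hc⟩ := parabolic_lower (![0, X] : Fin 2 → ℤ[X]) rfl (sb * j)
    have e : (B ^ j).1 = !![1, 0; c, 1] := by rw [hB, ← zpow_mul]; exact hc
    rw [hw]
    change ((B ^ j).1 * W.1) 0 0 = _
    rw [e]
    simp [Matrix.mul_apply, Fin.sum_univ_two]
  have hco : IsCoprime (α : ℤ) β' := by
    have h1 := (isCoprime_slope n).symm
    rw [Int.isCoprime_iff_nat_coprime] at h1 ⊢
    simpa [β', hα, Int.natAbs_mul, Int.natAbs_abs] using h1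
  have hmod : β ≡ β' [ZMOD α] ∨ β ≡ -β' [ZMOD α] := by
    rcases Int.units_eq_one_or σ with h3 | h3
    · simpa [β', h3] using h
    · simpa [β', h3] using h.symm
  obtain ⟨τ, hτ⟩ := exists_exponent_sign hodd hβ hco hmod sa
  have hW : W = ((List.range (α - 1)).map fun i =>
      topMatrix (i + 1 : ℕ) ^ ((τ : ℤ) * rileyEps α β (i + 1))).prod := by
    refine congrArg List.prod (List.map_congr_left fun i hi => ?_)
    have hi' := List.mem_range.1 hi
    rw [← hτ (i + 1) (by omega) (by omega)]
    simp only [latticeMeridian, zero_add, topMatrix, hA, hB, hsb]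
    split_ifs <;> rw [← zpow_mul, ← zpow_neg]
  rw [hw0, hW, ← rileyPoly_comp α β τ] at hsq
  exact sq_eq_sq_iff_eq_or_eq_neg.1 hsq

end Riley

end TwoBridge

/-! ### The theorem -/

theorem theorem4p14 (n : List ℤ) (hne : n ≠ []) (hn : ∀ m ∈ n, m ≠ 0)
    (hK : TwoBridge.IsKnot n) (o : TwoBridge.Orientation n) :
    ∃ Q : Polynomial ℤ, TwoBridge.repPoly o = Polynomial.X * Q ∧
      (∃ Φ : {y : ℂ // ∃ r : ℂ, Polynomial.aeval r Q = 0 ∧ r ^ 2 = y} ≃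
          TwoBridge.NonabelianParabolicClass n o,
        ∀ y, ∃ ρ : TwoBridge.NonabelianParabolicRep n o,
          Φ y = Quotient.mk (TwoBridge.conjSetoid n o) ρ ∧
          (ρ.1 (TwoBridge.meridian o (0, 0)) : Matrix (Fin 2) (Fin 2) ℂ) = !![1, 1; 0, 1] ∧
          (ρ.1 (TwoBridge.meridian o (0, 3)) : Matrix (Fin 2) (Fin 2) ℂ) =
            !![1, 0; -(y : ℂ), 1]) ∧
      (∀ (α : ℕ) (β : ℤ), α = (TwoBridge.slope n).2.natAbs → Odd β →
        (β ≡ (TwoBridge.slope n).1 [ZMOD α] ∨ β ≡ -(TwoBridge.slope n).1 [ZMOD α]) →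
        Q = (TwoBridge.rileyPoly α β).comp (Polynomial.X ^ 2) ∨
          Q = -(TwoBridge.rileyPoly α β).comp (Polynomial.X ^ 2)) := by
  obtain ⟨Q, hQ, hsign⟩ : ∃ Q, TwoBridge.repPoly o = Polynomial.X * Q ∧
      (Q = TwoBridge.closingPoly o ∨ Q = -TwoBridge.closingPoly o) := by
    unfold TwoBridge.repPoly
    rw [TwoBridge.closingBracket_eq]
    split_ifs
    · exact ⟨_, rfl, Or.inl rfl⟩
    · exact ⟨_, (mul_neg _ _).symm, Or.inr rfl⟩
  refine ⟨Q, hQ, ?_, fun α β hα hβ h => ?_⟩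
  · have hiff : ∀ y : ℂ, (∃ r : ℂ, Polynomial.aeval r Q = 0 ∧ r ^ 2 = y) ↔
        ∃ r : ℂ, Polynomial.aeval r (TwoBridge.closingPoly o) = 0 ∧ r ^ 2 = y := by
      intro y
      rcases hsign with rfl | rfl <;> simp
    refine ⟨(Equiv.subtypeEquivRight hiff).trans
      (Equiv.ofBijective _ (TwoBridge.rootClass_bijective hK)), fun y => ?_⟩
    have hspec := ((hiff y).1 y.2).choose_spec
    refine ⟨⟨TwoBridge.rootRep hspec.1, TwoBridge.isNonabelianParabolic_rootRep hK _⟩, rfl, ?_, ?_⟩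
    · rw [TwoBridge.rootRep_meridian_left]
      simp [TwoBridge.parabolic_coe]
    · rw [TwoBridge.rootRep_meridian_right]
      simp [TwoBridge.parabolic_coe, hspec.2]
  · have := TwoBridge.closingPoly_riley o hK hα hβ h
    rcases hsign with rfl | rfl
    · exact this
    · rw [neg_inj, neg_eq_iff_eq_neg]
      exact this.symm
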